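/- **Conventions.** $M$ is a smooth 7-manifold. A *Sasakian structure* on $M$ here means: a Riemannian metric $g$, a 1-form $\eta$, a vector field $\xi$ and an endomorphism $\Phi$ of $TM$, all smooth, with $\eta(\xi)=1$, $\Phi^2=-\mathrm{id}+\eta\otimes\xi$, $g(\Phi X,\Phi Y)=g(X,Y)-\eta(X)\eta(Y)$, $d\eta(X,Y)=g(\Phi X,Y)$ and $N_\Phi+d\eta\otimes\xi=0$, where $N_\Phi$ is the Nijenhuis tensor of $\Phi$ (with $d\eta(X,Y)=X\eta(Y)-Y\eta(X)-\eta([X,Y])$). Put $\omega=d\eta$ and $\mathcal D=\ker\eta$; $\Phi|_{\mathcal D}$ is the transverse complex structure. $(M^7,g,\eta,\Upsilon)$ is a *contact Calabi–Yau 7-manifold* if moreover $\Upsilon$ is a smooth, nowhere vanishing, closed complex 3-form with $\xi\lrcorner\Upsilon=0$, of type $(3,0)$ on $\mathcal D$, normalised by $\tfrac{1}{3!}\omega^3=\tfrac{i}{8}\Upsilon\wedge\overline{\Upsilon}$. Let $g_{\mathcal D}$ be the transverse metric (the restriction of $g$ to $\mathcal D$, extended by zero along $\xi$) and $\mathrm{vol}_{\mathcal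 D}=\tfrac1{3!}\omega^3$. A *$\mathrm G_2$-structure* on $M$ is a smooth 3-form $\varphi$ that at each point is linearly isomorphic to $e^{123}+e^{145}+e^{167}+e^{246}-e^{257}-e^{347}-e^{356}$ on $\mathbb R^7$; it determines a metric $g_\varphi$ and its volume form $\mathrm{vol}_\varphi$ by $6g_\varphi(X,Y)\mathrm{vol}_\varphi=(X\lrcorner\varphi)\wedge(Y\lrcorner\varphi)\wedge\varphi$, a Hodge star $*_\varphi$, the dual 4-form $\psi=*_\varphi\varphi$ and the Hodge Laplacian $\Delta_\varphi=dd^{*_\varphi}+d^{*_\varphi}d$. It is *coclosed* if $d\psi=0$. The *Laplacian flow* is $\partial_t\varphi_t=\Delta_{\varphi_t}\varphi_t$. **Theorem.** Let $(M^7,g_0,\eta_0,\Upsilon_0)$ be a (non-empty) contact Calabi–Yau 7-manifold, $\omega_0=d\eta_0$, $\mathcal D_0=\ker\eta_0$, and let $\epsilon>0$. Put $q(t)=(1-8\epsilon^2t)^{-1/2}$ and $T=\frac1{8\epsilon^2}$. The family $$\varphi_t=\epsilon q(t)\,\eta_0\wedge\omega_0+\mathrm{Re}\,\Upsilon_0,\qquad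 t\in(-\infty,T),$$ consists of coclosed $\mathrm G_2$-structures and solves the Laplacian flow with initial value $\varphi_0=\epsilon\,\eta_0\wedge\omega_0+\mathrm{Re}\,\Upsilon_0$. Its dual 4-form, metric and volume form are $$\psi_t=\tfrac12\omega_0^2-\epsilon q(t)\,\eta_0\wedge\mathrm{Im}\,\Upsilon_0,\qquad g_t=\epsilon^2q(t)^2\eta_0^2+g_{\mathcal D_0},\qquad \mathrm{vol}_t=\epsilon q(t)\,\eta_0\wedge\mathrm{vol}_{\mathcal D_0}.$$ Hence the solution is ancient, with a finite-time singularity (forwards in time) at $t=T$: at every point $g_t(\xi,\xi)\to\infty$ as $t\uparrow T$, and for no $a<T<b$ is there a solution of the Laplacian flow on $(a,b)$ that agrees with $\varphi_t$ for $t\in(a,T)$. -/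

import Mathlib

open scoped Manifold ContDiff Topology
open Set Filter

noncomputable section

namespace G2Flow

/-! ### Exterior algebra of a vector space -/

section LinearAlgebra

variable {V : Type*} [AddCommGroup V] [Module ℝ V] [TopologicalSpace V]
variable {A : Type*} [NormedCommRing A] [NormedAlgebra ℝ A]

/-- The multilinear map `v ↦ α (v₁, …, v_k) * β (v_{k+1}, …, v_{k+l})`. -/
def mulForms {k l : ℕ} (α : V [⋀^Fin k]→L[ℝ] A) (β : V [⋀^Fin l]→L[ℝ] A) :
    ContinuousMultilinearMap ℝ (fun _ : Fin (k + l) => V) A where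
  toMultilinearMap :=
    (LinearMap.mul' ℝ A).compMultilinearMap
      ((MultilinearMap.domCoprod α.toMultilinearMap β.toMultilinearMap).domDomCongr
        finSumFinEquiv)
  cont := by
    change Continuous fun v : Fin (k + l) → V =>
      α (fun i => v (finSumFinEquiv (Sum.inl i))) * β (fun i => v (finSumFinEquiv (Sum.inr i)))
    exact (α.cont.comp (continuous_pi fun i => continuous_apply _)).mul
      (β.cont.comp (continuous_pi fun i => continuous_apply _))

theorem mulForms_apply {k l : ℕ} (α : V [⋀^Fin k]→L[ℝ] A) (β : V [⋀^Fin l]→L[ℝ] A)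
    (v : Fin (k + l) → V) :
    mulForms α β v = α (fun i => v (Fin.castAdd l i)) * β (fun i => v (Fin.natAdd k i)) := rfl

/-- The wedge product, with the normalization
`(α ∧ β)(v) = 1 / (k! l!) * ∑_σ sign σ • α (v_{σ 1}, …, v_{σ k}) * β (v_{σ (k+1)}, …)`,
so that `e¹ ∧ ⋯ ∧ eᵏ` is the determinant. -/
def wedge {k l : ℕ} (α : V [⋀^Fin k]→L[ℝ] A) (β : V [⋀^Fin l]→L[ℝ] A) :
    V [⋀^Fin (k + l)]→L[ℝ] A :=
  ((k.factorial * l.factorial : ℝ)⁻¹) • (mulForms α β).alternatization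

theorem wedge_apply {k l : ℕ} (α : V [⋀^Fin k]→L[ℝ] A) (β : V [⋀^Fin l]→L[ℝ] A)
    (v : Fin (k + l) → V) :
    wedge α β v = ((k.factorial * l.factorial : ℝ)⁻¹) •
      ∑ σ : Equiv.Perm (Fin (k + l)), Equiv.Perm.sign σ •
        (α (fun i => v (σ (Fin.castAdd l i))) * β (fun i => v (σ (Fin.natAdd k i)))) := by
  simp [wedge, ContinuousMultilinearMap.alternatization_apply_apply, mulForms_apply]

/-- Contraction of a form with vectors in its first slots:
`(contract u β)(w) = β (u₁, …, u_k, w₁, …, w_l)`. For `k = 1` it is the interior product. -/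
def contract {k l n : ℕ} (h : k + l = n) (u : Fin k → V) (β : V [⋀^Fin n]→L[ℝ] A) :
    V [⋀^Fin l]→L[ℝ] A where
  toFun w := β (Fin.append u w ∘ Fin.cast h.symm)
  map_update_add' := by
    subst h
    intro _ w i x y
    obtain rfl : ‹DecidableEq (Fin l)› = instDecidableEqFin l := Subsingleton.elim _ _
    have key : ∀ z : V, Fin.append u (Function.update w i z) ∘ Fin.cast rfl
        = Function.update (Fin.append u w) (Fin.natAdd k i) z := by
      intro z; ext j
      refine Fin.addCases (fun a => ?_) (fun a => ?_) j
      · have : Fin.castAdd l a ≠ Fin.natAdd k i := by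
          intro hh; have := congrArg Fin.val hh; simp at this; omega
        simp [Function.update_of_ne this]
      · by_cases hai : a = i
        · subst hai; simp
        · have : Fin.natAdd k a ≠ Fin.natAdd k i := by
            intro hh; exact hai (Fin.natAdd_injective _ _ hh)
          simp [Function.update_of_ne this, Function.update_of_ne hai]
    simp only [key]
    exact β.map_update_add _ _ _ _
  map_update_smul' := by
    subst h
    intro _ w i c y
    obtain rfl : ‹DecidableEq (Fin l)› = instDecidableEqFin l := Subsingleton.elim _ _
    have key : ∀ z : V, Fin.append u (Function.update w i z) ∘ Fin.cast rfl
        = Function.update (Fin.append u w) (Fin.natAdd k i) z := by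
      intro z; ext j
      refine Fin.addCases (fun a => ?_) (fun a => ?_) j
      · have : Fin.castAdd l a ≠ Fin.natAdd k i := by
          intro hh; have := congrArg Fin.val hh; simp at this; omega
        simp [Function.update_of_ne this]
      · by_cases hai : a = i
        · subst hai; simp
        · have : Fin.natAdd k a ≠ Fin.natAdd k i := by
            intro hh; exact hai (Fin.natAdd_injective _ _ hh)
          simp [Function.update_of_ne this, Function.update_of_ne hai]
    simp only [key]
    exact β.map_update_smul _ _ _ _
  map_eq_zero_of_eq' := by
    subst h
    intro w i j hw hij
    refine β.map_eq_zero_of_eq _ (i := Fin.natAdd k i) (j := Fin.natAdd k j) ?_ ?_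
    · simpa using hw
    · intro hh; exact hij (Fin.natAdd_injective _ _ hh)
  cont := by
    subst h
    refine β.cont.comp (continuous_pi fun j => ?_)
    refine Fin.addCases (fun a => ?_) (fun a => ?_) j
    · simpa using continuous_const
    · simpa using continuous_apply a

/-- A frame is orthonormal for the bilinear form `g`. -/
def IsOrthonormalFrame (g : V →L[ℝ] V →L[ℝ] ℝ) (e : Fin 7 → V) : Prop :=
  ∀ i j, g (e i) (e j) = if i = j then 1 else 0

open Classical in
/-- Some `g`-orthonormal frame of a 7-dimensional space with inner product `g`. -/
def orthonormalFrame (g : V →L[ℝ] V →L[ℝ] ℝ) : Fin 7 → V :=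
  if h : ∃ e : Fin 7 → V, IsOrthonormalFrame g e then h.choose else 0

/-- The Hodge star of an inner product `g` with volume form `μ` on a 7-dimensional space:
`(⋆β)(w) = 1/k! * ∑_{i₁, …, i_k} β (e_{i₁}, …, e_{i_k}) μ (e_{i₁}, …, e_{i_k}, w₁, …, w_l)`
for an orthonormal frame `e` (the right-hand side does not depend on the frame). Thus
`⋆(e¹ ∧ ⋯ ∧ eᵏ) = e^{k+1} ∧ ⋯ ∧ e⁷` for oriented orthonormal coframes. -/
def hodgeStar (k l : ℕ) (h : k + l = 7) (g : V →L[ℝ] V →L[ℝ] ℝ) (μ : V [⋀^Fin 7]→L[ℝ] ℝ)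
    (β : V [⋀^Fin k]→L[ℝ] ℝ) : V [⋀^Fin l]→L[ℝ] ℝ :=
  (k.factorial : ℝ)⁻¹ • ∑ i : Fin k → Fin 7,
    β (orthonormalFrame g ∘ i) • contract h (orthonormalFrame g ∘ i) μ

/-- `g` is the inner product and `μ` the volume form determined by the 3-form `φ`:
`μ` is a unit volume form of the inner product `g`, and
`6 g(X, Y) μ = (X ⌟ φ) ∧ (Y ⌟ φ) ∧ φ`. -/
structure IsAssociated (φ : V [⋀^Fin 3]→L[ℝ] ℝ) (g : V →L[ℝ] V →L[ℝ] ℝ)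
    (μ : V [⋀^Fin 7]→L[ℝ] ℝ) : Prop where
  symm : ∀ X Y, g X Y = g Y X
  pos : ∀ X, X ≠ 0 → 0 < g X X
  unit : ∀ e : Fin 7 → V, IsOrthonormalFrame g e → |μ e| = 1
  compat : ∀ X Y, (6 * g X Y) • μ =
    wedge (wedge (contract (show 1 + 2 = 3 from rfl) ![X] φ)
      (contract (show 1 + 2 = 3 from rfl) ![Y] φ)) φ

open Classical in
/-- The pair (inner product, volume form) determined by a 3-form; zero if there is none. -/
def associatedPair (φ : V [⋀^Fin 3]→L[ℝ] ℝ) :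
    (V →L[ℝ] V →L[ℝ] ℝ) × (V [⋀^Fin 7]→L[ℝ] ℝ) :=
  if h : ∃ p : (V →L[ℝ] V →L[ℝ] ℝ) × (V [⋀^Fin 7]→L[ℝ] ℝ), IsAssociated φ p.1 p.2
  then h.choose else 0

end LinearAlgebra

/-- The model space `ℝ⁷`. -/
abbrev E7 : Type := EuclideanSpace ℝ (Fin 7)

/-- The coordinate 1-form `e^{i+1} = dx^{i+1}` on `ℝ⁷` (indices in `Fin 7` start at `0`). -/
def coordForm (i : Fin 7) : E7 [⋀^Fin 1]→L[ℝ] ℝ :=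
  ContinuousAlternatingMap.ofSubsingleton ℝ E7 ℝ (0 : Fin 1) (EuclideanSpace.proj i : E7 →L[ℝ] ℝ)

/-- `e^{(i+1)(j+1)(k+1)}` on `ℝ⁷`. -/
def coordForm3 (i j k : Fin 7) : E7 [⋀^Fin 3]→L[ℝ] ℝ :=
  wedge (wedge (coordForm i) (coordForm j)) (coordForm k)

/-- The standard `G₂` 3-form
`e¹²³ + e¹⁴⁵ + e¹⁶⁷ + e²⁴⁶ - e²⁵⁷ - e³⁴⁷ - e³⁵⁶` on `ℝ⁷`. -/
def stdG2Form : E7 [⋀^Fin 3]→L[ℝ] ℝ :=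
  coordForm3 0 1 2 + coordForm3 0 3 4 + coordForm3 0 5 6 + coordForm3 1 3 5
    - coordForm3 1 4 6 - coordForm3 2 3 6 - coordForm3 2 4 5

/-! ### Differential forms on 7-manifolds -/

section Manifold

variable (M : Type*) [TopologicalSpace M] [ChartedSpace E7 M]

/-- Differential `k`-forms (no smoothness assumed) on `M` with values in `F`. -/
abbrev DForm (k : ℕ) (F : Type*) [NormedAddCommGroup F] [NormedSpace ℝ F] : Type _ :=
  ∀ x : M, TangentSpace (𝓡 7) x [⋀^Fin k]→L[ℝ] F

/-- Fields of bilinear forms on the tangent spaces. -/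
abbrev BilinField : Type _ :=
  ∀ x : M, TangentSpace (𝓡 7) x →L[ℝ] TangentSpace (𝓡 7) x →L[ℝ] ℝ

variable {M}
variable {F : Type*} [NormedAddCommGroup F] [NormedSpace ℝ F]

/-- The expression of a form in the preferred chart at `x₀`, i.e. its pullback by the inverse
of the chart. -/
def DForm.inChart {k : ℕ} (α : DForm M k F) (x₀ : M) : E7 → E7 [⋀^Fin k]→L[ℝ] F :=
  fun y => (α ((extChartAt (𝓡 7) x₀).symm y)).compContinuousLinearMap
    (mfderiv 𝓘(ℝ, E7) (𝓡 7) (extChartAt (𝓡 7) x₀).symm y)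

/-- Smoothness of a form: it is smooth in all preferred charts. -/
def DForm.IsSmooth {k : ℕ} (α : DForm M k F) : Prop :=
  ∀ x₀ : M, ContDiffOn ℝ ∞ (α.inChart x₀) (extChartAt (𝓡 7) x₀).target

/-- The exterior derivative, computed at `x` in the chart at `x`. -/
def DForm.d {k : ℕ} (α : DForm M k F) : DForm M (k + 1) F :=
  fun x => (extDeriv (α.inChart x) (extChartAt (𝓡 7) x x)).compContinuousLinearMap
    (mfderiv (𝓡 7) 𝓘(ℝ, E7) (extChartAt (𝓡 7) x) x)

/-- The pointwise wedge product. -/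
def DForm.wedge {A : Type*} [NormedCommRing A] [NormedAlgebra ℝ A] {k l : ℕ}
    (α : DForm M k A) (β : DForm M l A) : DForm M (k + l) A :=
  fun x => G2Flow.wedge (α x) (β x)

/-- The real part of a complex form. -/
def DForm.re {k : ℕ} (α : DForm M k ℂ) : DForm M k ℝ :=
  fun x => Complex.reCLM.compContinuousAlternatingMap (α x)

/-- The imaginary part of a complex form. -/
def DForm.im {k : ℕ} (α : DForm M k ℂ) : DForm M k ℝ :=
  fun x => Complex.imCLM.compContinuousAlternatingMap (α x)

/-- The complex conjugate of a complex form. -/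
def DForm.conj {k : ℕ} (α : DForm M k ℂ) : DForm M k ℂ :=
  fun x => (Complex.conjCLE : ℂ →L[ℝ] ℂ).compContinuousAlternatingMap (α x)

/-- The pointwise Hodge star of a metric `g` with volume form `μ`. -/
def DForm.star (k l : ℕ) (h : k + l = 7) (g : BilinField M) (μ : DForm M 7 ℝ)
    (α : DForm M k ℝ) : DForm M l ℝ :=
  fun x => hodgeStar k l h (g x) (μ x) (α x)

/-- The codifferential `d^* = (-1)^k ⋆ d ⋆` on `k`-forms, `k = p + 1`, in dimension 7. -/
def DForm.codiff (p l : ℕ) (h : p + 1 + l = 7) (g : BilinField M) (μ : DForm M 7 ℝ)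
    (α : DForm M (p + 1) ℝ) : DForm M p ℝ :=
  (-1 : ℝ) ^ (p + 1) •
    DForm.star (l + 1) p (by omega) g μ (DForm.d (DForm.star (p + 1) l h g μ α))

/-- The Hodge Laplacian `d d^* + d^* d` on 3-forms. -/
def DForm.laplacian3 (g : BilinField M) (μ : DForm M 7 ℝ) (α : DForm M 3 ℝ) : DForm M 3 ℝ :=
  DForm.d (DForm.codiff 2 4 rfl g μ α) + DForm.codiff 3 3 rfl g μ (DForm.d α)

/-! ### `G₂`-structures and the Laplacian flow -/

/-- A `G₂`-structure: a smooth 3-form which is pointwise isomorphic to the standard one. -/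
def IsG2Structure (φ : DForm M 3 ℝ) : Prop :=
  φ.IsSmooth ∧ ∀ x : M, ∃ u : TangentSpace (𝓡 7) x ≃L[ℝ] E7,
    φ x = stdG2Form.compContinuousLinearMap (u : TangentSpace (𝓡 7) x →L[ℝ] E7)

/-- The metric `g_φ` of a `G₂`-structure. -/
def g2Metric (φ : DForm M 3 ℝ) : BilinField M := fun x => (associatedPair (φ x)).1

/-- The volume form `vol_φ` of a `G₂`-structure. -/
def g2Vol (φ : DForm M 3 ℝ) : DForm M 7 ℝ := fun x => (associatedPair (φ x)).2

/-- The dual 4-form `ψ = ⋆_φ φ` of a `G₂`-structure. -/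
def g2Dual (φ : DForm M 3 ℝ) : DForm M 4 ℝ :=
  DForm.star 3 4 rfl (g2Metric φ) (g2Vol φ) φ

/-- `φ` is coclosed: `d ⋆_φ φ = 0`. -/
def IsCoclosed (φ : DForm M 3 ℝ) : Prop := (g2Dual φ).d = 0

/-- The family `φ` of `G₂`-structures solves the Laplacian flow `∂φ_t/∂t = Δ_{φ_t} φ_t` for times
in `I`. The time derivative of the 3-form is taken in the fibre at each point of `M`. -/
def IsLaplacianFlow (φ : ℝ → DForm M 3 ℝ) (I : Set ℝ) : Prop :=
  ∀ t ∈ I, IsG2Structure (φ t) ∧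
    ∀ (x : M) (v : Fin 3 → TangentSpace (𝓡 7) x),
      HasDerivWithinAt (fun s => φ s x v)
        (DForm.laplacian3 (g2Metric (φ t)) (g2Vol (φ t)) (φ t) x v) I t

/-! ### Contact Calabi–Yau 7-manifolds -/

variable (M)

/-- A contact Calabi–Yau 7-manifold `(M, g, η, Υ)`. The Reeb field `ξ` and the endomorphism `Φ`
(the transverse complex structure, extended by `Φ ξ = 0`) of the Sasakian structure are determined
by `g` and `η`. -/
structure ContactCalabiYau [IsManifold (𝓡 7) ∞ M] where
  /-- the Riemannian metric -/
  g : Bundle.ContMDiffRiemannianMetric (𝓡 7) ∞ E7 (fun x : M => TangentSpace (𝓡 7) x)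
  /-- the contact form -/
  η : DForm M 1 ℝ
  /-- the Reeb vector field -/
  ξ : ∀ x : M, TangentSpace (𝓡 7) x
  /-- the structure endomorphism -/
  Φ : ∀ x : M, TangentSpace (𝓡 7) x →L[ℝ] TangentSpace (𝓡 7) x
  /-- the transverse holomorphic volume form -/
  Υ : DForm M 3 ℂ
  smooth_η : η.IsSmooth
  smooth_ξ : ContMDiff (𝓡 7) (𝓡 7).tangent ∞ (fun x => (⟨x, ξ x⟩ : TangentBundle (𝓡 7) M))
  smooth_Φ : ContMDiff (𝓡 7) ((𝓡 7).prod 𝓘(ℝ, E7 →L[ℝ] E7)) ∞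
    (fun x => Bundle.TotalSpace.mk' (E7 →L[ℝ] E7)
      (E := fun x : M => TangentSpace (𝓡 7) x →L[ℝ] TangentSpace (𝓡 7) x) x (Φ x))
  smooth_Υ : Υ.IsSmooth
  /-- almost contact structure -/
  η_ξ : ∀ x, η x ![ξ x] = 1
  Φ_sq : ∀ x X, Φ x (Φ x X) = -X + η x ![X] • ξ x
  /-- compatibility of the metric -/
  g_Φ : ∀ x X Y, g.inner x (Φ x X) (Φ x Y) = g.inner x X Y - η x ![X] * η x ![Y]
  /-- contact metric structure: `dη` is the Kähler form `g(Φ ·, ·)` of the transverse metric -/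
  dη_eq : ∀ x X Y, η.d x ![X, Y] = g.inner x (Φ x X) Y
  /-- normality: the Nijenhuis tensor of `Φ` satisfies `N_Φ + dη ⊗ ξ = 0` -/
  normal : ∀ X Y : ∀ x : M, TangentSpace (𝓡 7) x,
    ContMDiff (𝓡 7) (𝓡 7).tangent ∞ (fun x => (⟨x, X x⟩ : TangentBundle (𝓡 7) M)) →
    ContMDiff (𝓡 7) (𝓡 7).tangent ∞ (fun x => (⟨x, Y x⟩ : TangentBundle (𝓡 7) M)) →
    ∀ x, Φ x (Φ x (VectorField.mlieBracket (𝓡 7) X Y x))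
      + VectorField.mlieBracket (𝓡 7) (fun y => Φ y (X y)) (fun y => Φ y (Y y)) x
      - Φ x (VectorField.mlieBracket (𝓡 7) (fun y => Φ y (X y)) Y x)
      - Φ x (VectorField.mlieBracket (𝓡 7) X (fun y => Φ y (Y y)) x)
      + η.d x ![X x, Y x] • ξ x = 0
  /-- `Υ` is nowhere vanishing -/
  Υ_ne_zero : ∀ x, Υ x ≠ 0
  /-- `Υ` is transversal -/
  Υ_ξ : ∀ x X Y, Υ x ![ξ x, X, Y] = 0
  /-- `Υ` is of type `(3,0)` -/
  Υ_type : ∀ x X Y Z, Υ x ![Φ x X, Y, Z] = Complex.I * Υ x ![X, Y, Z]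
  /-- `Υ ∧ Ῡ = c₃ ω³` with `c₃ = (-1)^{3·4/2} (2i)³ / 3!`,
  equivalently `ω³ / 3! = (i/8) Υ ∧ Ῡ` -/
  Υ_norm : ∀ x v, (Υ.wedge Υ.conj) x v =
    ((-1) ^ (3 * 4 / 2) * (2 * Complex.I) ^ 3 / (Nat.factorial 3 : ℂ)) *
      ((((η.d).wedge (η.d)).wedge (η.d) x v : ℝ) : ℂ)
  closed_Υ : Υ.d = 0

variable {M} [IsManifold (𝓡 7) ∞ M]

namespace ContactCalabiYau

/-- The transverse Kähler form `ω = dη`. -/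
def kahler (C : ContactCalabiYau M) : DForm M 2 ℝ := C.η.d

/-- The transverse metric `g_𝒟`, extended by zero along the Reeb direction: `g` evaluated on the
projections to `𝒟 = ker η` along `ξ`. -/
def gD (C : ContactCalabiYau M) (x : M) (X Y : TangentSpace (𝓡 7) x) : ℝ :=
  C.g.inner x (X - C.η x ![X] • C.ξ x) (Y - C.η x ![Y] • C.ξ x)

/-- The transverse volume form `vol_𝒟 = ω³ / 3!`. -/
def volD (C : ContactCalabiYau M) : DForm M 6 ℝ :=
  ((Nat.factorial 3 : ℝ)⁻¹) • (C.kahler.wedge C.kahler).wedge C.kahler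

/-- The function `q(t) = (1 - 8ε²t)^{-1/2}`. -/
def q (ε t : ℝ) : ℝ := (1 - 8 * ε ^ 2 * t) ^ (-(1 / 2) : ℝ)

end ContactCalabiYau

end Manifold

end G2Flow

end

open scoped Manifold ContDiff Topology
open Set Filter

noncomputable section

namespace G2Flow

/-! ### Algebra of the wedge product -/

section WedgeAlgebra

variable {V W : Type*} [AddCommGroup V] [Module ℝ V] [TopologicalSpace V]
  [AddCommGroup W] [Module ℝ W] [TopologicalSpace W]
variable {A : Type*} [NormedCommRing A] [NormedAlgebra ℝ A] {k l : ℕ}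

/-! Fix r ≠ 0 and put φ = r η∧ω + Re Υ. At each point there is a unitary frame of ker η on which Υ
takes the value 1; it identifies the tangent space with ℝ ⊕ ℂ³ so that r η, ω and Υ become the first
coordinate covector, the standard Kähler form and dz¹∧dz²∧dz³ (`exists_adaptedEquiv`). Then φ
becomes the standard G₂-form, and its metric, volume form, dual ψ = ½ω² − r η∧Im Υ and ⋆(ω²) = 2r
η∧ω follow from computations with monomials on ℝ⁷ (`g2Form_properties`). Two points need care: the
metric and volume form are chosen from an existence statement, so they must be unique
(`IsAssociated.unique`), and the Hodge star uses a chosen frame, so it must not depend on it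
(`hodgeStar_pullback_std`).

The differential part rests on dη = ω, dω = 0, dΥ = 0 and the type identity ω∧Im Υ = 0. With the
Leibniz rule (`DForm.d_wedge_apply`) they give d(η∧ω) = ω² and dψ = 0. Hence d*φ = 0 and Δφ = ⋆d⋆(r
ω²) = ⋆d(2r² η∧ω) = 2r² ⋆ω² = 4r³ η∧ω (`laplacian3_g2Form`).

So the flow within this family is the ODE r' = 4r³ with r(0) = ε, whose solution εq(t) blows up at
T. The Reeb field has squared length r², so the metrics blow up everywhere. Since η∧ω vanishes
nowhere, φ_t on suitable fixed vectors is unbounded as t ↑ T, whereas a flow through time T is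
continuous in t there. -/

theorem wedge_add_left (α α' : V [⋀^Fin k]→L[ℝ] A) (β : V [⋀^Fin l]→L[ℝ] A) :
    wedge (α + α') β = wedge α β + wedge α' β := by
  ext v
  simp [wedge_apply, add_mul, smul_add, Finset.sum_add_distrib]

theorem wedge_add_right (α : V [⋀^Fin k]→L[ℝ] A) (β β' : V [⋀^Fin l]→L[ℝ] A) :
    wedge α (β + β') = wedge α β + wedge α β' := by
  ext v
  simp [wedge_apply, mul_add, smul_add, Finset.sum_add_distrib]

theorem wedge_smul_left (c : ℝ) (α : V [⋀^Fin k]→L[ℝ] A) (β : V [⋀^Fin l]→L[ℝ] A) :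
    wedge (c • α) β = c • wedge α β := by
  ext v
  simp only [wedge_apply, ContinuousAlternatingMap.smul_apply, smul_mul_assoc,
    smul_comm _ c, ← Finset.smul_sum]

theorem wedge_smul_right (c : ℝ) (α : V [⋀^Fin k]→L[ℝ] A) (β : V [⋀^Fin l]→L[ℝ] A) :
    wedge α (c • β) = c • wedge α β := by
  ext v
  simp only [wedge_apply, ContinuousAlternatingMap.smul_apply, mul_smul_comm,
    smul_comm _ c, ← Finset.smul_sum]

theorem wedge_neg_right (α : V [⋀^Fin k]→L[ℝ] A) (β : V [⋀^Fin l]→L[ℝ] A)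
    [IsTopologicalAddGroup V] : wedge α (-β) = -wedge α β := by
  ext v; simp [wedge_apply]

theorem wedge_sub_right [IsTopologicalAddGroup V]
    (α : V [⋀^Fin k]→L[ℝ] A) (β β' : V [⋀^Fin l]→L[ℝ] A) :
    wedge α (β - β') = wedge α β - wedge α β' := by
  rw [sub_eq_add_neg, wedge_add_right, wedge_neg_right, sub_eq_add_neg]

theorem wedge_zero_left (β : V [⋀^Fin l]→L[ℝ] A) :
    wedge (0 : V [⋀^Fin k]→L[ℝ] A) β = 0 := by
  ext v; simp [wedge_apply]

theorem wedge_zero_right (α : V [⋀^Fin k]→L[ℝ] A) :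
    wedge α (0 : V [⋀^Fin l]→L[ℝ] A) = 0 := by
  ext v; simp [wedge_apply]

theorem wedge_sum_left {ι : Type*} (s : Finset ι) (α : ι → V [⋀^Fin k]→L[ℝ] A)
    (β : V [⋀^Fin l]→L[ℝ] A) : wedge (∑ i ∈ s, α i) β = ∑ i ∈ s, wedge (α i) β := by
  classical
  induction s using Finset.induction_on with
  | empty => simp [wedge_zero_left]
  | insert a s ha ih => rw [Finset.sum_insert ha, Finset.sum_insert ha, wedge_add_left, ih]

theorem wedge_sum_right {ι : Type*} (s : Finset ι) (α : V [⋀^Fin k]→L[ℝ] A)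
    (β : ι → V [⋀^Fin l]→L[ℝ] A) : wedge α (∑ i ∈ s, β i) = ∑ i ∈ s, wedge α (β i) := by
  classical
  induction s using Finset.induction_on with
  | empty => simp [wedge_zero_right]
  | insert a s ha ih => rw [Finset.sum_insert ha, Finset.sum_insert ha, wedge_add_right, ih]

theorem wedge_compContinuousLinearMap (α : W [⋀^Fin k]→L[ℝ] A) (β : W [⋀^Fin l]→L[ℝ] A)
    (f : V →L[ℝ] W) :
    (wedge α β).compContinuousLinearMap f =
      wedge (α.compContinuousLinearMap f) (β.compContinuousLinearMap f) := by
  ext v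
  simp [wedge_apply, Function.comp_def]

theorem contract_compContinuousLinearMap {n : ℕ} (h : k + l = n) (u : Fin k → V)
    (β : W [⋀^Fin n]→L[ℝ] A) (f : V →L[ℝ] W) :
    contract h u (β.compContinuousLinearMap f) =
      (contract h (f ∘ u) β).compContinuousLinearMap f := by
  subst h
  ext w
  change β _ = β _
  congr 1
  ext j
  refine Fin.addCases (fun a => ?_) (fun a => ?_) j <;> simp

/-- The decomposable form `a₁ ∧ ⋯ ∧ aₖ`, as a determinant. -/
def detForm (a : Fin k → V →L[ℝ] A) : V [⋀^Fin k]→L[ℝ] A where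
  toFun v := Matrix.det (Matrix.of fun i j => a j (v i))
  map_update_add' := by
    intro _ v i x y
    obtain rfl : ‹DecidableEq (Fin k)› = instDecidableEqFin k := Subsingleton.elim _ _
    have key : ∀ z, (Matrix.of fun i' j => a j (Function.update v i z i'))
        = (Matrix.of fun i' j => a j (v i')).updateRow i (fun j => a j z) := by
      intro z; ext i' j
      by_cases h : i' = i
      · subst h; simp
      · simp [h]
    rw [key, key, key, ← Matrix.det_updateRow_add]
    congr 2; ext j; simp
  map_update_smul' := by
    intro _ v i c x
    obtain rfl : ‹DecidableEq (Fin k)› = instDecidableEqFin k := Subsingleton.elim _ _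
    have key : ∀ z, (Matrix.of fun i' j => a j (Function.update v i z i'))
        = (Matrix.of fun i' j => a j (v i')).updateRow i (fun j => a j z) := by
      intro z; ext i' j
      by_cases h : i' = i
      · subst h; simp
      · simp [h]
    rw [key, key, Algebra.smul_def, ← smul_eq_mul (algebraMap ℝ A c), smul_eq_mul,
      ← Matrix.det_updateRow_smul]
    congr 2; ext j; simp [Algebra.smul_def]
  map_eq_zero_of_eq' := by
    intro v i j h hij
    exact Matrix.det_zero_of_row_eq hij (by ext m; simp [h])
  cont := by
    change Continuous fun v : Fin k → V => Matrix.det (Matrix.of fun i j => a j (v i))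
    refine Continuous.matrix_det (continuous_matrix fun i j => ?_)
    exact (a j).continuous.comp (continuous_apply i)

theorem detForm_apply (a : Fin k → V →L[ℝ] A) (v : Fin k → V) :
    detForm a v = Matrix.det (Matrix.of fun i j => a j (v i)) := rfl

theorem detForm_eq_zero_of_eq (a : Fin k → V →L[ℝ] A) {i j : Fin k} (hij : i ≠ j)
    (h : a i = a j) : detForm a = 0 := by
  ext v
  exact Matrix.det_zero_of_column_eq hij (by intro m; simp [h])

theorem detForm_perm (a : Fin k → V →L[ℝ] A) (σ : Equiv.Perm (Fin k)) :
    detForm (a ∘ σ) = (Equiv.Perm.sign σ : ℝ) • detForm a := by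
  ext v
  rw [ContinuousAlternatingMap.smul_apply, detForm_apply, detForm_apply]
  have := Matrix.det_permute' σ (Matrix.of fun i j => a j (v i))
  rw [show (Matrix.of fun i j => (a ∘ σ) j (v i))
    = (Matrix.of fun i j => a j (v i)).submatrix id σ from rfl, this]
  rcases Int.units_eq_one_or (Equiv.Perm.sign σ) with h | h <;> simp [h]

/-- Expand both small determinants over permutations τ and ρ. For each pair the sum over σ is the
full determinant, so the k! l! equal contributions cancel the normalization of `wedge`. -/
theorem wedge_detForm (a : Fin k → V →L[ℝ] A) (b : Fin l → V →L[ℝ] A) :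
    wedge (detForm a) (detForm b) = detForm (Fin.append a b) := by
  ext v
  set D : A := detForm (Fin.append a b) v with hD
  have hterm : ∀ (τ : Equiv.Perm (Fin k)) (ρ : Equiv.Perm (Fin l)),
      ∑ σ : Equiv.Perm (Fin (k + l)), Equiv.Perm.sign σ •
        ((Equiv.Perm.sign τ • ∏ i, a i (v (σ (Fin.castAdd l (τ i))))) *
          (Equiv.Perm.sign ρ • ∏ i, b i (v (σ (Fin.natAdd k (ρ i)))))) = D := by
    intro τ ρ
    -- The block permutation τ ⊕ ρ; the substitution σ ↦ σπ absorbs τ and ρ, and their signs, into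
    -- σ.
    let π : Equiv.Perm (Fin (k + l)) := finSumFinEquiv.permCongr (Equiv.sumCongr τ ρ)
    have hπl : ∀ i, π (Fin.castAdd l i) = Fin.castAdd l (τ i) := by
      intro i; simp [π, Equiv.permCongr_apply]
    have hπr : ∀ i, π (Fin.natAdd k i) = Fin.natAdd k (ρ i) := by
      intro i; simp [π, Equiv.permCongr_apply]
    have hsign : Equiv.Perm.sign π = Equiv.Perm.sign τ * Equiv.Perm.sign ρ := by
      rw [Equiv.Perm.sign_permCongr]; exact Equiv.Perm.sign_sumCongr τ ρ
    rw [hD, detForm_apply, Matrix.det_apply]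
    refine Fintype.sum_equiv (Equiv.mulRight π) _ _ fun σ => ?_
    rw [Fin.prod_univ_add]
    simp only [Equiv.coe_mulRight, Equiv.Perm.sign_mul, Equiv.Perm.mul_apply, Matrix.of_apply,
      Fin.append_left, Fin.append_right, hπl, hπr, hsign, smul_mul_smul_comm, smul_smul]
  rw [wedge_apply]
  have : ∀ σ : Equiv.Perm (Fin (k + l)),
      Equiv.Perm.sign σ • (detForm a (fun i => v (σ (Fin.castAdd l i))) *
        detForm b (fun i => v (σ (Fin.natAdd k i)))) =
      ∑ τ : Equiv.Perm (Fin k), ∑ ρ : Equiv.Perm (Fin l), Equiv.Perm.sign σ •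
        ((Equiv.Perm.sign τ • ∏ i, a i (v (σ (Fin.castAdd l (τ i))))) *
          (Equiv.Perm.sign ρ • ∏ i, b i (v (σ (Fin.natAdd k (ρ i)))))) := by
    intro σ
    rw [detForm_apply, detForm_apply, Matrix.det_apply, Matrix.det_apply, Finset.sum_mul_sum,
      Finset.smul_sum]
    refine Finset.sum_congr rfl fun τ _ => ?_
    rw [Finset.smul_sum]
    rfl
  simp only [this]
  rw [Finset.sum_comm, Finset.sum_congr rfl fun τ _ => Finset.sum_comm]
  simp only [hterm]
  simp only [Finset.sum_const, Finset.card_univ, Fintype.card_perm, Fintype.card_fin]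
  rw [← Nat.cast_smul_eq_nsmul ℝ, ← Nat.cast_smul_eq_nsmul ℝ, smul_smul, smul_smul]
  rw [mul_assoc, inv_mul_cancel₀ (by positivity), one_smul]

end WedgeAlgebra

/-! ### Coordinate monomials on `ℝ⁷` -/

/-- The standard basis vectors of `ℝ⁷`. -/
def stdVec (i : Fin 7) : E7 := EuclideanSpace.single i 1

theorem stdVec_apply (i j : Fin 7) : (stdVec j) i = if i = j then (1 : ℝ) else 0 := by
  simp [stdVec]

theorem sum_apply_smul_stdVec (x : E7) : x = ∑ i, x i • stdVec i := by
  ext j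
  simp [stdVec_apply]

/-- The monomial `dx^{I₁} ∧ ⋯ ∧ dx^{Iₖ}` on `ℝ⁷`. -/
def idxForm {k : ℕ} (I : Fin k → Fin 7) : E7 [⋀^Fin k]→L[ℝ] ℝ :=
  detForm fun a => (EuclideanSpace.proj (I a) : E7 →L[ℝ] ℝ)

theorem idxForm_apply {k : ℕ} (I : Fin k → Fin 7) (v : Fin k → E7) :
    idxForm I v = Matrix.det (Matrix.of fun i j => v i (I j)) := rfl

theorem wedge_idxForm {k l : ℕ} (I : Fin k → Fin 7) (J : Fin l → Fin 7) :
    wedge (idxForm I) (idxForm J) = idxForm (Fin.append I J) := by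
  rw [idxForm, idxForm, wedge_detForm, idxForm]
  congr 1
  funext a
  refine Fin.addCases (fun i => ?_) (fun i => ?_) a <;> simp

theorem idxForm_eq_zero {k : ℕ} {I : Fin k → Fin 7} (h : ¬ Function.Injective I) :
    idxForm I = 0 := by
  simp only [Function.Injective, not_forall] at h
  obtain ⟨i, j, hij, hne⟩ := h
  exact detForm_eq_zero_of_eq _ hne (by rw [hij])

theorem idxForm_perm {k : ℕ} (I : Fin k → Fin 7) (σ : Equiv.Perm (Fin k)) :
    idxForm (I ∘ σ) = (Equiv.Perm.sign σ : ℝ) • idxForm I :=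
  detForm_perm (fun a => (EuclideanSpace.proj (I a) : E7 →L[ℝ] ℝ)) σ

theorem coordForm_eq (i : Fin 7) : coordForm i = idxForm ![i] := by
  ext v
  simp [coordForm, idxForm_apply]

theorem coordForm3_eq (i j k : Fin 7) : coordForm3 i j k = idxForm ![i, j, k] := by
  rw [coordForm3, coordForm_eq, coordForm_eq, coordForm_eq, wedge_idxForm, wedge_idxForm]
  congr 1
  ext a
  fin_cases a <;> rfl

/-- The standard volume form of `ℝ⁷`. -/
def stdVol : E7 [⋀^Fin 7]→L[ℝ] ℝ := idxForm id

theorem stdVol_apply (v : Fin 7 → E7) :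
    stdVol v = Matrix.det (Matrix.of fun i j => v i j) := idxForm_apply id v

/-- The sign of a sequence of indices: that of the permutation it defines, zero if an index
is repeated. -/
def seqSign {n : ℕ} (I : Fin n → Fin 7) : ℤ :=
  ∏ j, ∏ i ∈ Finset.Iio j, if I i < I j then 1 else if I j < I i then -1 else 0

theorem seqSign_of_not_injective {n : ℕ} {I : Fin n → Fin 7} (h : ¬ Function.Injective I) :
    seqSign I = 0 := by
  simp only [Function.Injective, not_forall] at h
  obtain ⟨i, j, hij, hne⟩ := h
  rcases lt_or_gt_of_ne hne with hlt | hlt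
  · refine Finset.prod_eq_zero (Finset.mem_univ j) ?_
    exact Finset.prod_eq_zero (Finset.mem_Iio.2 hlt) (by simp [hij])
  · refine Finset.prod_eq_zero (Finset.mem_univ i) ?_
    exact Finset.prod_eq_zero (Finset.mem_Iio.2 hlt) (by simp [hij])

theorem seqSign_perm (σ : Equiv.Perm (Fin 7)) :
    seqSign σ = Equiv.Perm.sign σ := by
  rw [Equiv.Perm.sign_eq_prod_prod_Iio, seqSign, Units.coe_prod]
  refine Finset.prod_congr rfl fun j _ => ?_
  rw [Units.coe_prod]
  refine Finset.prod_congr rfl fun i hi => ?_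
  have hne : σ i ≠ σ j := fun h => (Finset.mem_Iio.1 hi).ne (σ.injective h)
  by_cases h : σ i < σ j
  · simp [h]
  · have : σ j < σ i := lt_of_le_of_ne (not_lt.1 h) hne.symm
    simp [h, this]

/-- This turns identities between 7-forms on ℝ⁷ into identities between integers, which can be
decided. -/
theorem idxForm_eq_seqSign_smul (I : Fin 7 → Fin 7) : idxForm I = (seqSign I : ℝ) • stdVol := by
  by_cases h : Function.Injective I
  · let σ : Equiv.Perm (Fin 7) := Equiv.ofBijective I (Finite.injective_iff_bijective.1 h)
    have hI : I = id ∘ σ := rfl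
    rw [stdVol, hI, idxForm_perm]
    congr 1
    rw [show (id ∘ σ : Fin 7 → Fin 7) = σ from rfl, seqSign_perm]
  · rw [idxForm_eq_zero h, seqSign_of_not_injective h]
    simp

/-- The coefficients of `stdG2Form`. -/
def g2Coeff : Fin 7 → ℤ := ![1, 1, 1, 1, -1, -1, -1]

/-- The monomials of `stdG2Form`. -/
def g2Index : Fin 7 → Fin 3 → Fin 7 :=
  ![![0, 1, 2], ![0, 3, 4], ![0, 5, 6], ![1, 3, 5], ![1, 4, 6], ![2, 3, 6], ![2, 4, 5]]

/-- The coefficients of the contractions of `stdG2Form` with the basis vectors. -/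
def g2ContractCoeff : Fin 7 → Fin 3 → ℤ :=
  ![![1, 1, 1], ![-1, 1, -1], ![1, -1, -1], ![-1, -1, 1], ![1, 1, 1], ![-1, 1, -1], ![1, -1, -1]]

/-- The monomials of the contractions of `stdG2Form` with the basis vectors. -/
def g2ContractIndex : Fin 7 → Fin 3 → Fin 2 → Fin 7 :=
  ![![![1, 2], ![3, 4], ![5, 6]], ![![0, 2], ![3, 5], ![4, 6]], ![![0, 1], ![3, 6], ![4, 5]],
    ![![0, 4], ![1, 5], ![2, 6]], ![![0, 3], ![1, 6], ![2, 5]], ![![0, 6], ![1, 3], ![2, 4]],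
    ![![0, 5], ![1, 4], ![2, 3]]]

theorem stdG2Form_eq_sum : stdG2Form = ∑ t, (g2Coeff t : ℝ) • idxForm (g2Index t) := by
  simp only [stdG2Form, coordForm3_eq, Fin.sum_univ_seven, g2Coeff, g2Index]
  have h : ∀ β : E7 [⋀^Fin 3]→L[ℝ] ℝ, (-1 : ℝ) • β = -β := fun β => by ext v; simp
  simp [sub_eq_add_neg, h]

theorem contract_one_two_apply {V : Type*} [AddCommGroup V] [Module ℝ V] [TopologicalSpace V]
    (X : V) (β : V [⋀^Fin 3]→L[ℝ] ℝ) (w : Fin 2 → V) :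
    contract (show 1 + 2 = 3 from rfl) ![X] β w = β ![X, w 0, w 1] := by
  change β _ = β _
  congr 1
  funext j
  fin_cases j <;> rfl

theorem contract_stdG2Form (i : Fin 7) :
    contract (show 1 + 2 = 3 from rfl) ![stdVec i] stdG2Form =
      ∑ m, (g2ContractCoeff i m : ℝ) • idxForm (g2ContractIndex i m) := by
  ext w
  rw [contract_one_two_apply, stdG2Form_eq_sum]
  simp only [Fin.sum_univ_seven, Fin.sum_univ_three, ContinuousAlternatingMap.add_apply,
    ContinuousAlternatingMap.smul_apply, idxForm_apply, Matrix.det_fin_three, Matrix.det_fin_two]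
  fin_cases i <;>
    simp [g2Coeff, g2Index, g2ContractCoeff, g2ContractIndex, stdVec_apply] <;> ring

/-- Boolean tests on natural numbers reduce well in the kernel; with `seqSignSeven` they give a form
of `seqSign` suited to `decide`. -/
def pairSign (a b : ℕ) : ℤ := bif Nat.blt a b then 1 else bif Nat.blt b a then -1 else 0

def seqSignSeven (a b c d e f g : ℕ) : ℤ :=
  pairSign a b * (pairSign a c * pairSign b c * (pairSign a d * pairSign b d * pairSign c d *
    (pairSign a e * pairSign b e * pairSign c e * pairSign d e *
      (pairSign a f * pairSign b f * pairSign c f * pairSign d f * pairSign e f *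
        (pairSign a g * pairSign b g * pairSign c g * pairSign d g * pairSign e g *
          pairSign f g)))))

theorem pairSign_val (i j : Fin 7) :
    pairSign i j = if i < j then 1 else if j < i then -1 else 0 := by
  simp only [pairSign, Bool.cond_eq_ite, Nat.blt_eq, Fin.val_fin_lt]

theorem seqSign_seven (I : Fin 7 → Fin 7) : seqSign I =
    seqSignSeven (I 0) (I 1) (I 2) (I 3) (I 4) (I 5) (I 6) := by
  have h0 : Finset.Iio (0 : Fin 7) = ∅ := rfl
  have h1 : Finset.Iio (1 : Fin 7) = {0} := rfl
  have h2 : Finset.Iio (2 : Fin 7) = {0, 1} := rfl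
  have h3 : Finset.Iio (3 : Fin 7) = {0, 1, 2} := rfl
  have h4 : Finset.Iio (4 : Fin 7) = {0, 1, 2, 3} := rfl
  have h5 : Finset.Iio (5 : Fin 7) = {0, 1, 2, 3, 4} := rfl
  have h6 : Finset.Iio (6 : Fin 7) = {0, 1, 2, 3, 4, 5} := rfl
  simp only [seqSign, Fin.prod_univ_seven, ← pairSign_val, h0, h1, h2, h3, h4, h5, h6,
    seqSignSeven]
  simp [mul_assoc]
-- The integer content of (e_i ⌟ φ) ∧ (e_j ⌟ φ) ∧ φ = 6 δ_ij vol: each triple of monomials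
-- contributes its coefficients times the sign of the concatenated indices.
theorem g2_compat_table : ∀ i j : Fin 7,
    (∑ m : Fin 3, ∑ n : Fin 3, ∑ t : Fin 7,
      g2ContractCoeff i m * (g2ContractCoeff j n * (g2Coeff t *
        seqSignSeven (g2ContractIndex i m 0) (g2ContractIndex i m 1) (g2ContractIndex j n 0)
          (g2ContractIndex j n 1) (g2Index t 0) (g2Index t 1) (g2Index t 2)))) =
            if i = j then 6 else 0 := by
  decide +kernel

/-! ### The metric and volume form of the standard `G₂`-structure -/

section Associated

variable {V : Type*} [AddCommGroup V] [Module ℝ V] [TopologicalSpace V]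

theorem contract_one_two_sum {ι : Type*} (s : Finset ι) (c : ι → ℝ) (X : ι → V)
    (β : V [⋀^Fin 3]→L[ℝ] ℝ) :
    contract (show 1 + 2 = 3 from rfl) ![∑ i ∈ s, c i • X i] β =
      ∑ i ∈ s, c i • contract (show 1 + 2 = 3 from rfl) ![X i] β := by
  ext w
  let L : V →ₗ[ℝ] ℝ :=
    { toFun := fun x => β ![x, w 0, w 1]
      map_add' := fun x y => β.vecCons_add _ x y
      map_smul' := fun a x => β.vecCons_smul _ a x }
  rw [contract_one_two_apply, ContinuousAlternatingMap.sum_apply]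
  change L _ = _
  simp [contract_one_two_apply, L, map_sum]

/-- The standard inner product of `ℝ⁷` as a bilinear form. -/
def stdInner : E7 →L[ℝ] E7 →L[ℝ] ℝ := innerSL ℝ

theorem stdInner_apply (x y : E7) : stdInner x y = ∑ i, x i * y i := by
  rw [stdInner, innerSL_apply_apply, PiLp.inner_apply]
  simp [mul_comm]

theorem isOrthonormalFrame_stdVec : IsOrthonormalFrame stdInner stdVec := by
  intro i j
  simp [stdInner_apply, stdVec_apply, eq_comm]

theorem wedge_contract_stdG2Form (i j : Fin 7) :
    wedge (wedge (contract (show 1 + 2 = 3 from rfl) ![stdVec i] stdG2Form)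
      (contract (show 1 + 2 = 3 from rfl) ![stdVec j] stdG2Form)) stdG2Form =
    (if i = j then 6 else 0 : ℝ) • stdVol := by
  have key : ∀ m n t, idxForm (k := 7) (Fin.append (Fin.append (g2ContractIndex i m)
      (g2ContractIndex j n)) (g2Index t)) = (seqSignSeven (g2ContractIndex i m 0)
        (g2ContractIndex i m 1) (g2ContractIndex j n 0) (g2ContractIndex j n 1) (g2Index t 0)
        (g2Index t 1) (g2Index t 2) : ℝ) • stdVol := by
    intro m n t
    rw [idxForm_eq_seqSign_smul, seqSign_seven]
    rfl
  simp only [contract_stdG2Form, wedge_sum_left, wedge_sum_right, wedge_smul_left,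
    wedge_smul_right, wedge_idxForm]
  rw [stdG2Form_eq_sum]
  simp only [wedge_sum_right, wedge_smul_right, wedge_idxForm]
  have h := g2_compat_table i j
  have h' := congrArg (Int.cast : ℤ → ℝ) h
  push_cast at h'
  rw [← h']
  simp only [key, smul_smul, ← Finset.sum_smul]
  congr 1
  simp only [Finset.mul_sum]
  rw [Finset.sum_comm]
  refine Finset.sum_congr rfl fun m _ => Finset.sum_congr rfl fun n _ =>
    Finset.sum_congr rfl fun t _ => by ring

/-- The frame vectors are the rows of the matrix. A square matrix with orthonormal rows has
orthonormal columns, and the column relations are the ones needed in sums over a frame. -/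
theorem transpose_mul_self_of_isOrthonormalFrame {e : Fin 7 → E7}
    (he : IsOrthonormalFrame stdInner e) :
    (Matrix.of fun i j => e i j).transpose * (Matrix.of fun i j => e i j) = 1 := by
  rw [mul_eq_one_comm]
  ext i j
  rw [Matrix.mul_apply, Matrix.one_apply, ← he i j, stdInner_apply]
  rfl

theorem isAssociated_std : IsAssociated stdG2Form stdInner stdVol where
  symm X Y := by simp [stdInner_apply, mul_comm]
  pos X hX := by
    have : stdInner X X = ‖X‖ ^ 2 := by
      rw [stdInner, innerSL_apply_apply, real_inner_self_eq_norm_sq]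
    rw [this]
    have := norm_pos_iff.2 hX
    positivity
  unit e he := by
    have h := congrArg Matrix.det (transpose_mul_self_of_isOrthonormalFrame he)
    rw [Matrix.det_mul, Matrix.det_transpose, Matrix.det_one, ← stdVol_apply] at h
    rcases mul_self_eq_one_iff.1 h with h | h <;> rw [h] <;> simp
  compat X Y := by
    -- Both sides are bilinear in X and Y, so the basis vectors decide.
    conv_rhs => rw [sum_apply_smul_stdVec X, sum_apply_smul_stdVec Y]
    simp only [contract_one_two_sum, wedge_sum_left, wedge_sum_right, wedge_smul_left,
      wedge_smul_right, wedge_contract_stdG2Form]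
    rw [stdInner_apply]
    simp only [smul_smul, ← Finset.sum_smul, Finset.mul_sum]
    congr 1
    simp only [mul_ite, mul_zero, Finset.sum_ite_eq', Finset.mem_univ, if_true]
    exact Finset.sum_congr rfl fun i _ => by ring

/-- The pullback of a bilinear form. -/
def pullbackBilin {W : Type*} [AddCommGroup W] [Module ℝ W] [TopologicalSpace W]
    (g : W →L[ℝ] W →L[ℝ] ℝ) (u : V →L[ℝ] W) : V →L[ℝ] V →L[ℝ] ℝ :=
  (ContinuousLinearMap.precomp ℝ u).comp (g.comp u)

variable {W : Type*} [AddCommGroup W] [Module ℝ W] [TopologicalSpace W]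

theorem pullbackBilin_apply (g : W →L[ℝ] W →L[ℝ] ℝ) (u : V →L[ℝ] W) (X Y : V) :
    pullbackBilin g u X Y = g (u X) (u Y) := rfl

theorem IsOrthonormalFrame.map {g : W →L[ℝ] W →L[ℝ] ℝ} {u : V →L[ℝ] W} {e : Fin 7 → V}
    (he : IsOrthonormalFrame (pullbackBilin g u) e) : IsOrthonormalFrame g (u ∘ e) := he

theorem IsOrthonormalFrame.symm_comp {g : W →L[ℝ] W →L[ℝ] ℝ} (u : V ≃L[ℝ] W) {e : Fin 7 → W}
    (he : IsOrthonormalFrame g e) :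
    IsOrthonormalFrame (pullbackBilin g (u : V →L[ℝ] W)) (u.symm ∘ e) := by
  intro i j
  simp [pullbackBilin_apply, he i j]

theorem IsAssociated.pullback {φ : W [⋀^Fin 3]→L[ℝ] ℝ} {g : W →L[ℝ] W →L[ℝ] ℝ}
    {μ : W [⋀^Fin 7]→L[ℝ] ℝ} (h : IsAssociated φ g μ) (u : V ≃L[ℝ] W) :
    IsAssociated (φ.compContinuousLinearMap (u : V →L[ℝ] W)) (pullbackBilin g (u : V →L[ℝ] W))
      (μ.compContinuousLinearMap (u : V →L[ℝ] W)) where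
  symm X Y := h.symm _ _
  pos X hX := h.pos _ (by simpa using hX)
  unit e he := h.unit _ he.map
  compat X Y := by
    rw [contract_compContinuousLinearMap, contract_compContinuousLinearMap]
    have hv : ∀ Z : V, ((u : V →L[ℝ] W) : V → W) ∘ ![Z] = ![u Z] := fun Z => by
      funext i; rw [Subsingleton.elim i 0]; rfl
    rw [hv, hv]
    refine (congrArg (fun α => α.compContinuousLinearMap (u : V →L[ℝ] W))
      (h.compat (u X) (u Y))).trans ?_
    refine (wedge_compContinuousLinearMap (wedge _ _) φ _).trans ?_
    exact congrArg (fun α => wedge α _) (wedge_compContinuousLinearMap _ _ _)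

/-- The compatibility identity fixes only the product of metric and volume: μ' = cμ and g = c g',
with c > 0 by positivity of both metrics. Rescaling e by s = √c makes it orthonormal for g', and the
unit condition then reads c s⁷ = s⁹ = 1, so s = 1. -/
theorem IsAssociated.unique {φ : V [⋀^Fin 3]→L[ℝ] ℝ} {g g' : V →L[ℝ] V →L[ℝ] ℝ}
    {μ μ' : V [⋀^Fin 7]→L[ℝ] ℝ} (h : IsAssociated φ g μ) (h' : IsAssociated φ g' μ')
    {e : Fin 7 → V} (he : IsOrthonormalFrame g e) : g' = g ∧ μ' = μ := by
  have hcomp : ∀ X Y, (6 * g X Y) • μ = (6 * g' X Y) • μ' := fun X Y => by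
    rw [h.compat, h'.compat]
  have hμ : μ e ≠ 0 := fun h0 => by simpa [h0] using h.unit e he
  have he0 : e 0 ≠ 0 := fun h0 => by simpa [h0] using he 0 0
  have hpos' := h'.pos _ he0
  obtain ⟨c, hc0, hc⟩ : ∃ c : ℝ, 0 < c ∧ μ' = c • μ := by
    refine ⟨1 / g' (e 0) (e 0), by positivity, ?_⟩
    have := hcomp (e 0) (e 0)
    rw [he 0 0] at this
    ext v
    have hv := congrArg (fun α => α v) this
    simp only [ContinuousAlternatingMap.smul_apply, smul_eq_mul, if_true] at hv ⊢
    field_simp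
    linarith
  have hg : ∀ X Y, g X Y = c * g' X Y := fun X Y => by
    have := congrArg (fun α => α e) (hcomp X Y)
    simp only [hc, ContinuousAlternatingMap.smul_apply, smul_eq_mul] at this
    have h2 : (g X Y - c * g' X Y) * μ e = 0 := by linarith
    rcases mul_eq_zero.1 h2 with h2 | h2
    · linarith
    · exact absurd h2 hμ
  set s := Real.sqrt c
  have hs0 : 0 < s := Real.sqrt_pos.2 hc0
  have hsc : s * s = c := Real.mul_self_sqrt hc0.le
  have hframe : IsOrthonormalFrame g' (fun i => s • e i) := by
    intro i j
    rw [← he i j, hg]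
    simp only [map_smul, smul_apply, smul_eq_mul]
    rw [← hsc]; ring
  have h1 := h'.unit _ hframe
  rw [hc, ContinuousAlternatingMap.smul_apply,
    ContinuousAlternatingMap.map_smul_univ μ (fun _ => s) e] at h1
  simp only [Finset.prod_const, Finset.card_univ, Fintype.card_fin, smul_eq_mul, abs_mul,
    h.unit e he, mul_one, abs_of_pos hc0, abs_of_pos (pow_pos hs0 7)] at h1
  have hs1 : s = 1 := by
    rw [← hsc] at h1
    have : s ^ 9 = 1 := by linarith [h1, show s ^ 9 = s * s * s ^ 7 by ring]
    exact (pow_eq_one_iff_of_nonneg hs0.le (by norm_num)).1 this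
  have hc1 : c = 1 := by rw [← hsc, hs1, mul_one]
  refine ⟨?_, by rw [hc, hc1, one_smul]⟩
  ext X Y
  rw [hg, hc1, one_mul]

/-- By uniqueness, the arbitrary choice in `associatedPair` can only return the given pair. -/
theorem IsAssociated.associatedPair_eq {φ : V [⋀^Fin 3]→L[ℝ] ℝ} {g : V →L[ℝ] V →L[ℝ] ℝ}
    {μ : V [⋀^Fin 7]→L[ℝ] ℝ} (h : IsAssociated φ g μ) {e : Fin 7 → V}
    (he : IsOrthonormalFrame g e) : associatedPair φ = (g, μ) := by
  have hex : ∃ p : (V →L[ℝ] V →L[ℝ] ℝ) × (V [⋀^Fin 7]→L[ℝ] ℝ), IsAssociated φ p.1 p.2 :=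
    ⟨(g, μ), h⟩
  rw [associatedPair, dif_pos hex]
  obtain ⟨h1, h2⟩ := h.unique hex.choose_spec he
  exact Prod.ext h1 h2

theorem associatedPair_pullback_std (u : V ≃L[ℝ] E7) :
    associatedPair (stdG2Form.compContinuousLinearMap (u : V →L[ℝ] E7)) =
      (pullbackBilin stdInner (u : V →L[ℝ] E7),
        stdVol.compContinuousLinearMap (u : V →L[ℝ] E7)) :=
  (isAssociated_std.pullback u).associatedPair_eq (isOrthonormalFrame_stdVec.symm_comp u)

end Associated

/-! ### The Hodge star on `ℝ⁷` -/

section HodgeStar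

/-- The contraction of two multilinear maps over a frame is invariant under orthogonal changes of
the frame. -/
theorem sum_multilinear_mul_of_orthogonal {k : ℕ}
    (F G : MultilinearMap ℝ (fun _ : Fin k => E7) ℝ) {e : Fin 7 → E7}
    (he : IsOrthonormalFrame stdInner e) :
    ∑ i : Fin k → Fin 7, F (e ∘ i) * G (e ∘ i) =
      ∑ i : Fin k → Fin 7, F (stdVec ∘ i) * G (stdVec ∘ i) := by
  have hA := transpose_mul_self_of_isOrthonormalFrame he
  have hexp : ∀ (H : MultilinearMap ℝ (fun _ : Fin k => E7) ℝ) (i : Fin k → Fin 7),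
      H (e ∘ i) = ∑ r : Fin k → Fin 7, (∏ a, e (i a) (r a)) * H (stdVec ∘ r) := by
    intro H i
    have h1 : e ∘ i = fun a => ∑ j, e (i a) j • stdVec j := by
      funext a
      exact sum_apply_smul_stdVec _
    rw [h1, H.map_sum]
    refine Finset.sum_congr rfl fun r _ => ?_
    rw [H.map_smul_univ (fun a => e (i a) (r a)) (fun a => stdVec (r a))]
    rfl
  -- The sum over multi-indices of a product is a product of sums, one for each slot; each factor is
  -- an orthonormality relation between columns of e.
  have hδ : ∀ r q : Fin k → Fin 7,
      ∑ i : Fin k → Fin 7, (∏ a, e (i a) (r a)) * (∏ a, e (i a) (q a)) =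
        if r = q then 1 else 0 := by
    intro r q
    simp only [← Finset.prod_mul_distrib]
    have h2 := Finset.prod_univ_sum (fun _ : Fin k => (Finset.univ : Finset (Fin 7)))
      (fun a m => e m (r a) * e m (q a))
    rw [Fintype.piFinset_univ] at h2
    rw [← h2]
    have h3 : ∀ a, ∑ m, e m (r a) * e m (q a) = if r a = q a then 1 else 0 := by
      intro a
      have := congrFun (congrFun hA (r a)) (q a)
      rw [Matrix.mul_apply, Matrix.one_apply] at this
      exact this
    simp only [h3]
    by_cases hrq : r = q
    · simp [hrq]
    · rw [if_neg hrq]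
      obtain ⟨a, ha⟩ := Function.ne_iff.1 hrq
      exact Finset.prod_eq_zero (Finset.mem_univ a) (if_neg ha)
  calc ∑ i : Fin k → Fin 7, F (e ∘ i) * G (e ∘ i)
      = ∑ i : Fin k → Fin 7, ∑ r : Fin k → Fin 7, ∑ q : Fin k → Fin 7,
          (F (stdVec ∘ r) * G (stdVec ∘ q)) *
            ((∏ a, e (i a) (r a)) * (∏ a, e (i a) (q a))) := by
        refine Finset.sum_congr rfl fun i _ => ?_
        rw [hexp F, hexp G, Finset.sum_mul_sum]
        exact Finset.sum_congr rfl fun r _ => Finset.sum_congr rfl fun q _ => by ring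
    _ = ∑ r : Fin k → Fin 7, ∑ q : Fin k → Fin 7, ∑ i : Fin k → Fin 7,
          (F (stdVec ∘ r) * G (stdVec ∘ q)) *
            ((∏ a, e (i a) (r a)) * (∏ a, e (i a) (q a))) := by
        rw [Finset.sum_comm]
        exact Finset.sum_congr rfl fun r _ => Finset.sum_comm
    _ = _ := by
        simp only [← Finset.mul_sum, hδ, mul_ite, mul_one, mul_zero, Finset.sum_ite_eq,
          Finset.mem_univ, if_true]

variable {V : Type*} [AddCommGroup V] [Module ℝ V] [TopologicalSpace V]

/-- `contract` as a multilinear map of the contracted vectors. -/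
def contractMultilinear {k l n : ℕ} (h : k + l = n) (μ : V [⋀^Fin n]→L[ℝ] ℝ) (w : Fin l → V) :
    MultilinearMap ℝ (fun _ : Fin k => V) ℝ :=
  (LinearMap.mk ⟨fun f : MultilinearMap ℝ (fun _ : Fin l => V) ℝ => f w, fun _ _ => rfl⟩
    fun _ _ => rfl).compMultilinearMap
  ((μ.toMultilinearMap.domDomCongr ((finCongr h.symm).trans finSumFinEquiv.symm)).currySum)

theorem contractMultilinear_apply {k l n : ℕ} (h : k + l = n) (μ : V [⋀^Fin n]→L[ℝ] ℝ)
    (w : Fin l → V) (u : Fin k → V) : contractMultilinear h μ w u = contract h u μ w := by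
  subst h
  change μ _ = μ _
  congr 1
  funext j
  refine Fin.addCases (fun a => ?_) (fun a => ?_) j <;> simp

/-- Permuting the contracted vectors permutes all arguments of μ by σ ⊕ id, which has the sign of σ.
-/
theorem contract_comp_perm {k l n : ℕ} (h : k + l = n) (μ : V [⋀^Fin n]→L[ℝ] ℝ)
    (u : Fin k → V) (σ : Equiv.Perm (Fin k)) :
    contract h (u ∘ σ) μ = (Equiv.Perm.sign σ : ℝ) • contract h u μ := by
  subst h
  ext w
  let π : Equiv.Perm (Fin (k + l)) := finSumFinEquiv.permCongr (Equiv.sumCongr σ 1)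
  have hsign : Equiv.Perm.sign π = Equiv.Perm.sign σ := by
    rw [Equiv.Perm.sign_permCongr]
    exact (Equiv.Perm.sign_sumCongr σ 1).trans (by simp)
  have hπ : Fin.append (u ∘ σ) w ∘ Fin.cast rfl = (Fin.append u w ∘ Fin.cast rfl) ∘ π := by
    funext j
    refine Fin.addCases (fun a => ?_) (fun a => ?_) j <;>
      simp [π, Equiv.permCongr_apply]
  change μ (Fin.append (u ∘ σ) w ∘ Fin.cast rfl) = _ * μ (Fin.append u w ∘ Fin.cast rfl)
  rw [hπ]
  refine (μ.toAlternatingMap.map_perm _ π).trans ?_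
  rw [hsign]
  rcases Int.units_eq_one_or (Equiv.Perm.sign σ) with h | h <;> simp [h]

theorem hodgeStar_std_eq_of_frame {k l : ℕ} (h : k + l = 7) (μ : E7 [⋀^Fin 7]→L[ℝ] ℝ)
    (β : E7 [⋀^Fin k]→L[ℝ] ℝ) {e : Fin 7 → E7} (he : IsOrthonormalFrame stdInner e) :
    ∑ i : Fin k → Fin 7, β (e ∘ i) • contract h (e ∘ i) μ =
      ∑ i : Fin k → Fin 7, β (stdVec ∘ i) • contract h (stdVec ∘ i) μ := by
  ext w
  have := sum_multilinear_mul_of_orthogonal β.toMultilinearMap (contractMultilinear h μ w) he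
  simp only [contractMultilinear_apply] at this
  simp only [ContinuousAlternatingMap.sum_apply, ContinuousAlternatingMap.smul_apply,
    smul_eq_mul]
  exact this

/-- Whatever frame `orthonormalFrame` picks, u carries it to a frame orthonormal for `stdInner`, and
the sum defining the star is the same for all of these. -/
theorem hodgeStar_pullback_std {k l : ℕ} (h : k + l = 7) (u : V ≃L[ℝ] E7)
    (μ : E7 [⋀^Fin 7]→L[ℝ] ℝ) (β : E7 [⋀^Fin k]→L[ℝ] ℝ) :
    hodgeStar k l h (pullbackBilin stdInner (u : V →L[ℝ] E7))
      (μ.compContinuousLinearMap (u : V →L[ℝ] E7)) (β.compContinuousLinearMap (u : V →L[ℝ] E7)) =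
    ((k.factorial : ℝ)⁻¹ • ∑ i : Fin k → Fin 7,
      β (stdVec ∘ i) • contract h (stdVec ∘ i) μ).compContinuousLinearMap (u : V →L[ℝ] E7) := by
  set g := pullbackBilin stdInner (u : V →L[ℝ] E7)
  have hex : ∃ e : Fin 7 → V, IsOrthonormalFrame g e :=
    ⟨_, isOrthonormalFrame_stdVec.symm_comp u⟩
  have hfr : IsOrthonormalFrame g (orthonormalFrame g) := by
    rw [orthonormalFrame, dif_pos hex]
    exact hex.choose_spec
  rw [← hodgeStar_std_eq_of_frame h μ β hfr.map]
  ext w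
  simp only [hodgeStar, contract_compContinuousLinearMap, ContinuousAlternatingMap.smul_apply,
    ContinuousAlternatingMap.sum_apply, ContinuousAlternatingMap.compContinuousLinearMap_apply]
  rfl

theorem hodgeStar_smul {k l : ℕ} (h : k + l = 7) (g : V →L[ℝ] V →L[ℝ] ℝ)
    (μ : V [⋀^Fin 7]→L[ℝ] ℝ) (c : ℝ) (β : V [⋀^Fin k]→L[ℝ] ℝ) :
    hodgeStar k l h g μ (c • β) = c • hodgeStar k l h g μ β := by
  simp only [hodgeStar, ContinuousAlternatingMap.smul_apply, smul_assoc, ← Finset.smul_sum]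
  rw [smul_comm]

/-- The Hodge star of the standard inner product and volume form of `ℝ⁷`, in the standard
frame. -/
def stdStar {k l : ℕ} (h : k + l = 7) (β : E7 [⋀^Fin k]→L[ℝ] ℝ) : E7 [⋀^Fin l]→L[ℝ] ℝ :=
  (k.factorial : ℝ)⁻¹ • ∑ i : Fin k → Fin 7, β (stdVec ∘ i) • contract h (stdVec ∘ i) stdVol

theorem hodgeStar_pullback_stdVol {k l : ℕ} (h : k + l = 7) (u : V ≃L[ℝ] E7)
    (β : E7 [⋀^Fin k]→L[ℝ] ℝ) :
    hodgeStar k l h (pullbackBilin stdInner (u : V →L[ℝ] E7))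
      (stdVol.compContinuousLinearMap (u : V →L[ℝ] E7))
      (β.compContinuousLinearMap (u : V →L[ℝ] E7)) =
    (stdStar h β).compContinuousLinearMap (u : V →L[ℝ] E7) :=
  hodgeStar_pullback_std h u stdVol β

theorem stdStar_add {k l : ℕ} (h : k + l = 7) (β β' : E7 [⋀^Fin k]→L[ℝ] ℝ) :
    stdStar h (β + β') = stdStar h β + stdStar h β' := by
  simp [stdStar, add_smul, Finset.sum_add_distrib]

theorem stdStar_smul {k l : ℕ} (h : k + l = 7) (c : ℝ) (β : E7 [⋀^Fin k]→L[ℝ] ℝ) :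
    stdStar h (c • β) = c • stdStar h β := by
  simp only [stdStar, ContinuousAlternatingMap.smul_apply, smul_assoc, ← Finset.smul_sum]
  rw [smul_comm]

theorem stdStar_sub {k l : ℕ} (h : k + l = 7) (β β' : E7 [⋀^Fin k]→L[ℝ] ℝ) :
    stdStar h (β - β') = stdStar h β - stdStar h β' := by
  simp [stdStar, sub_smul, Finset.sum_sub_distrib, smul_sub]

/-- The evaluation matrix is block triangular with an identity block: injectivity makes the indices
in I distinct and keeps those of K away from I. Only the minor of w on the columns K survives. -/
theorem contract_stdVec_idxForm {k l n : ℕ} (h : k + l = n) (I : Fin k → Fin 7)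
    (K : Fin l → Fin 7) (hinj : Function.Injective (Fin.append I K)) :
    contract h (stdVec ∘ I) (idxForm (Fin.append I K ∘ Fin.cast h.symm)) = idxForm K := by
  subst h
  ext w
  change idxForm _ (Fin.append (stdVec ∘ I) w ∘ Fin.cast rfl) = _
  rw [idxForm_apply, idxForm_apply, ← Matrix.det_submatrix_equiv_self finSumFinEquiv]
  have : (Matrix.of fun i j => (Fin.append (stdVec ∘ I) w ∘ Fin.cast rfl) i
      ((Fin.append I K ∘ Fin.cast rfl) j)).submatrix finSumFinEquiv finSumFinEquiv =
      Matrix.fromBlocks (1 : Matrix (Fin k) (Fin k) ℝ) 0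
        (Matrix.of fun i j => w i (I j)) (Matrix.of fun i j => w i (K j)) := by
    ext i j
    rcases i with i | i <;> rcases j with j | j
    · have h1 : I j = I i ↔ i = j := by
        constructor
        · intro hij
          have := @hinj (Fin.castAdd l j) (Fin.castAdd l i) (by simpa using hij)
          exact ((Fin.castAdd_injective _ _) this).symm
        · rintro rfl; rfl
      simp [stdVec_apply, h1, Matrix.one_apply]
    · have h1 : K j ≠ I i := by
        intro hij
        have := congrArg Fin.val (@hinj (Fin.natAdd k j) (Fin.castAdd l i) (by simpa using hij))
        simp at this
        omega
      simp [stdVec_apply, h1]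
    · simp
    · simp
  rw [this, Matrix.det_fromBlocks_zero₁₂, Matrix.det_one, one_mul]

theorem idxForm_stdVec_comp {k : ℕ} {I : Fin k → Fin 7} (i : Fin k → Fin 7) :
    idxForm I (stdVec ∘ i) =
      ∑ σ : Equiv.Perm (Fin k), (Equiv.Perm.sign σ : ℝ) * if i = I ∘ σ then 1 else 0 := by
  rw [idxForm_apply, ← Matrix.det_transpose, Matrix.det_apply']
  refine Finset.sum_congr rfl fun σ _ => ?_
  congr 1
  simp only [Matrix.transpose_apply, Matrix.of_apply, Function.comp_apply, stdVec_apply]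
  rw [Finset.prod_ite_zero]
  simp only [Finset.prod_const_one, Finset.mem_univ, true_imp_iff]
  refine if_congr ?_ rfl rfl
  rw [funext_iff]
  exact forall_congr' fun a => eq_comm

/-- Only the rearrangements I ∘ σ contribute. The sign of σ appears once from the monomial and once
from the contraction, so the k! terms are equal and cancel 1/k!. -/
theorem stdStar_idxForm {k l : ℕ} (h : k + l = 7) (I : Fin k → Fin 7) (K : Fin l → Fin 7) (s : ℤ)
    (hs : seqSign (Fin.append I K ∘ Fin.cast h.symm) = s) (hs0 : s * s = 1) :
    stdStar h (idxForm I) = (s : ℝ) • idxForm K := by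
  -- A repeated index would give sign 0, against s² = 1; so K enumerates the complement of I.
  have hinj : Function.Injective (Fin.append I K) := by
    by_contra hn
    have : ¬ Function.Injective (Fin.append I K ∘ Fin.cast h.symm) := fun hi => hn <| by
      have := hi.comp (Fin.cast_injective h)
      exact this
    rw [seqSign_of_not_injective this] at hs
    rw [← hs] at hs0
    simp at hs0
  have hvol : stdVol = (s : ℝ) • idxForm (Fin.append I K ∘ Fin.cast h.symm) := by
    rw [idxForm_eq_seqSign_smul, hs, smul_smul]
    rw [show (s : ℝ) * s = 1 by exact_mod_cast hs0, one_smul]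
  have hcontract : contract h (stdVec ∘ I) stdVol = (s : ℝ) • idxForm K := by
    rw [hvol, ← contract_stdVec_idxForm h I K hinj]
    rfl
  have hsum : ∑ i : Fin k → Fin 7, idxForm I (stdVec ∘ i) • contract h (stdVec ∘ i) stdVol =
      ∑ σ : Equiv.Perm (Fin k), contract h (stdVec ∘ I) stdVol := by
    simp only [idxForm_stdVec_comp, Finset.sum_smul]
    rw [Finset.sum_comm]
    refine Finset.sum_congr rfl fun σ _ => ?_
    simp only [mul_ite, mul_one, mul_zero, ite_smul, zero_smul, Finset.sum_ite_eq',
      Finset.mem_univ, if_true]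
    rw [← Function.comp_assoc, contract_comp_perm, smul_smul]
    rcases Int.units_eq_one_or (Equiv.Perm.sign σ) with h | h <;> simp [h]
  rw [stdStar, hsum, hcontract, Finset.sum_const, Finset.card_univ, Fintype.card_perm,
    Fintype.card_fin, ← Nat.cast_smul_eq_nsmul ℝ, smul_smul,
    inv_mul_cancel₀ (by positivity), one_smul]

end HodgeStar

/-! ### The standard transverse Calabi–Yau structure on `ℝ⁷` -/

section StdCalabiYau

/-- The standard transverse Kähler form on `ℝ⁷ = ℝ ⊕ ℂ³`. -/
def stdKahler : E7 [⋀^Fin 2]→L[ℝ] ℝ := idxForm ![1, 2] + idxForm ![3, 4] + idxForm ![5, 6]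

/-- The real part of the standard transverse holomorphic volume form on `ℝ⁷ = ℝ ⊕ ℂ³`. -/
def stdRe : E7 [⋀^Fin 3]→L[ℝ] ℝ :=
  idxForm ![1, 3, 5] - idxForm ![1, 4, 6] - idxForm ![2, 3, 6] - idxForm ![2, 4, 5]

/-- The imaginary part of the standard transverse holomorphic volume form on
`ℝ⁷ = ℝ ⊕ ℂ³`. -/
def stdIm : E7 [⋀^Fin 3]→L[ℝ] ℝ :=
  idxForm ![1, 3, 6] + idxForm ![1, 4, 5] + idxForm ![2, 3, 5] - idxForm ![2, 4, 6]

theorem wedge_idxForm_eq {k l : ℕ} {I : Fin k → Fin 7} {J : Fin l → Fin 7}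
    {K : Fin (k + l) → Fin 7} (h : Fin.append I J = K) :
    wedge (idxForm I) (idxForm J) = idxForm K := by
  rw [wedge_idxForm, h]

theorem wedge_idxForm_eq_zero {k l : ℕ} {I : Fin k → Fin 7} {J : Fin l → Fin 7}
    (i : Fin k) (j : Fin l) (h : I i = J j) :
    wedge (idxForm I) (idxForm J) = 0 := by
  rw [wedge_idxForm, idxForm_eq_zero]
  intro hinj
  have := congrArg Fin.val (@hinj (Fin.castAdd l i) (Fin.natAdd k j) (by simpa using h))
  simp at this
  omega

/-- Exchanging two blocks of length two is the square of a rotation of four letters, hence even. -/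
theorem wedge_idxForm_comm_two (a b c d : Fin 7) :
    wedge (idxForm ![a, b]) (idxForm ![c, d]) = idxForm ![c, d, a, b] := by
  rw [wedge_idxForm_eq (K := ![c, d, a, b] ∘ finRotate 4 ∘ finRotate 4) (by
    funext i; fin_cases i <;> rfl)]
  have h := idxForm_perm ![c, d, a, b] (finRotate 4 * finRotate 4)
  rw [Equiv.Perm.sign_mul, Int.units_mul_self] at h
  simpa using h

theorem stdG2Form_eq : stdG2Form = wedge (idxForm ![0]) stdKahler + stdRe := by
  rw [stdKahler, wedge_add_right, wedge_add_right,
    wedge_idxForm_eq (K := ![0, 1, 2]) (by decide),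
    wedge_idxForm_eq (K := ![0, 3, 4]) (by decide),
    wedge_idxForm_eq (K := ![0, 5, 6]) (by decide), stdRe]
  simp only [stdG2Form, coordForm3_eq]
  ext v
  simp only [ContinuousAlternatingMap.add_apply, ContinuousAlternatingMap.sub_apply]
  ring

theorem wedge_stdKahler_stdKahler : wedge stdKahler stdKahler =
    (2 : ℝ) • (idxForm ![1, 2, 3, 4] + idxForm ![1, 2, 5, 6] + idxForm ![3, 4, 5, 6]) := by
  simp only [stdKahler, wedge_add_right, wedge_add_left]
  rw [wedge_idxForm_eq_zero (I := ![1, 2]) (J := ![1, 2]) 0 0 rfl,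
    wedge_idxForm_eq_zero (I := ![3, 4]) (J := ![3, 4]) 0 0 rfl,
    wedge_idxForm_eq_zero (I := ![5, 6]) (J := ![5, 6]) 0 0 rfl,
    wedge_idxForm_comm_two 3 4 1 2, wedge_idxForm_comm_two 5 6 1 2,
    wedge_idxForm_comm_two 5 6 3 4,
    wedge_idxForm_eq (I := ![1, 2]) (J := ![3, 4]) (K := ![1, 2, 3, 4]) (by decide),
    wedge_idxForm_eq (I := ![1, 2]) (J := ![5, 6]) (K := ![1, 2, 5, 6]) (by decide),
    wedge_idxForm_eq (I := ![3, 4]) (J := ![5, 6]) (K := ![3, 4, 5, 6]) (by decide)]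
  simp only [zero_add, add_zero]
  ext v
  simp only [ContinuousAlternatingMap.add_apply, ContinuousAlternatingMap.smul_apply,
    smul_eq_mul]
  ring

/-- Each monomial of `stdIm` takes one index from each of {1,2}, {3,4}, {5,6}, and each monomial of
`stdKahler` is a whole such pair, so every product repeats an index. In complex terms, a (1,1)-form
times a (3,0)- or (0,3)-form is zero in dimension three. -/
theorem wedge_stdKahler_stdIm : wedge stdKahler stdIm = 0 := by
  simp only [stdKahler, stdIm, wedge_add_right, wedge_add_left, wedge_sub_right]
  rw [wedge_idxForm_eq_zero (I := ![1, 2]) (J := ![1, 3, 6]) 0 0 rfl,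
    wedge_idxForm_eq_zero (I := ![1, 2]) (J := ![1, 4, 5]) 0 0 rfl,
    wedge_idxForm_eq_zero (I := ![1, 2]) (J := ![2, 3, 5]) 1 0 rfl,
    wedge_idxForm_eq_zero (I := ![1, 2]) (J := ![2, 4, 6]) 1 0 rfl,
    wedge_idxForm_eq_zero (I := ![3, 4]) (J := ![1, 3, 6]) 0 1 rfl,
    wedge_idxForm_eq_zero (I := ![3, 4]) (J := ![1, 4, 5]) 1 1 rfl,
    wedge_idxForm_eq_zero (I := ![3, 4]) (J := ![2, 3, 5]) 0 1 rfl,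
    wedge_idxForm_eq_zero (I := ![3, 4]) (J := ![2, 4, 6]) 1 1 rfl,
    wedge_idxForm_eq_zero (I := ![5, 6]) (J := ![1, 3, 6]) 1 2 rfl,
    wedge_idxForm_eq_zero (I := ![5, 6]) (J := ![1, 4, 5]) 0 2 rfl,
    wedge_idxForm_eq_zero (I := ![5, 6]) (J := ![2, 3, 5]) 0 2 rfl,
    wedge_idxForm_eq_zero (I := ![5, 6]) (J := ![2, 4, 6]) 1 2 rfl]
  simp

theorem wedge_stdKahler_cube : wedge (wedge stdKahler stdKahler) stdKahler =
    (6 : ℝ) • idxForm ![1, 2, 3, 4, 5, 6] := by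
  rw [wedge_stdKahler_stdKahler, wedge_smul_left]
  simp only [stdKahler, wedge_add_right, wedge_add_left]
  have h1 : wedge (idxForm ![1, 2, 5, 6]) (idxForm ![3, 4]) = idxForm ![1, 2, 3, 4, 5, 6] := by
    rw [wedge_idxForm_eq (K := ![1, 2, 3, 4, 5, 6] ∘ ![0, 1, 4, 5, 2, 3]) (by decide)]
    have h := idxForm_perm ![1, 2, 3, 4, 5, 6]
      ⟨![0, 1, 4, 5, 2, 3], ![0, 1, 4, 5, 2, 3], by decide, by decide⟩
    rw [show Equiv.Perm.sign (⟨![0, 1, 4, 5, 2, 3], ![0, 1, 4, 5, 2, 3], by decide, by decide⟩ :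
      Equiv.Perm (Fin 6)) = 1 by decide] at h
    simpa using h
  have h2 : wedge (idxForm ![3, 4, 5, 6]) (idxForm ![1, 2]) = idxForm ![1, 2, 3, 4, 5, 6] := by
    rw [wedge_idxForm_eq (K := ![1, 2, 3, 4, 5, 6] ∘ ![2, 3, 4, 5, 0, 1]) (by decide)]
    have h := idxForm_perm ![1, 2, 3, 4, 5, 6]
      ⟨![2, 3, 4, 5, 0, 1], ![4, 5, 0, 1, 2, 3], by decide, by decide⟩
    rw [show Equiv.Perm.sign (⟨![2, 3, 4, 5, 0, 1], ![4, 5, 0, 1, 2, 3], by decide, by decide⟩ :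
      Equiv.Perm (Fin 6)) = 1 by decide] at h
    simpa using h
  rw [wedge_idxForm_eq_zero (I := ![1, 2, 3, 4]) (J := ![1, 2]) 0 0 rfl,
    wedge_idxForm_eq_zero (I := ![1, 2, 3, 4]) (J := ![3, 4]) 2 0 rfl,
    wedge_idxForm_eq_zero (I := ![1, 2, 5, 6]) (J := ![1, 2]) 0 0 rfl,
    wedge_idxForm_eq_zero (I := ![1, 2, 5, 6]) (J := ![5, 6]) 2 0 rfl,
    wedge_idxForm_eq_zero (I := ![3, 4, 5, 6]) (J := ![3, 4]) 0 0 rfl,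
    wedge_idxForm_eq_zero (I := ![3, 4, 5, 6]) (J := ![5, 6]) 2 0 rfl,
    wedge_idxForm_eq (I := ![1, 2, 3, 4]) (J := ![5, 6]) (K := ![1, 2, 3, 4, 5, 6]) (by decide),
    h1, h2]
  simp only [zero_add, add_zero]
  ext v
  simp only [ContinuousAlternatingMap.add_apply, ContinuousAlternatingMap.smul_apply,
    smul_eq_mul]
  ring

theorem smul_compContinuousLinearMap {V W : Type*} [AddCommGroup V] [Module ℝ V]
    [TopologicalSpace V] [AddCommGroup W] [Module ℝ W] [TopologicalSpace W] {k : ℕ} (c : ℝ)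
    (α : W [⋀^Fin k]→L[ℝ] ℝ) (f : V →L[ℝ] W) :
    (c • α).compContinuousLinearMap f = c • α.compContinuousLinearMap f := rfl

/-- The 6-form `κ³`. -/
def cube {V : Type*} [AddCommGroup V] [Module ℝ V] [TopologicalSpace V]
    (κ : V [⋀^Fin 2]→L[ℝ] ℝ) : V [⋀^Fin 6]→L[ℝ] ℝ :=
  wedge (wedge κ κ) κ

/-- The transverse volume form `κ³ / 6`. -/
def transverseVol {V : Type*} [AddCommGroup V] [Module ℝ V] [TopologicalSpace V]
    (κ : V [⋀^Fin 2]→L[ℝ] ℝ) : V [⋀^Fin 6]→L[ℝ] ℝ :=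
  (6 : ℝ)⁻¹ • cube κ

theorem cube_compContinuousLinearMap {V W : Type*} [AddCommGroup V] [Module ℝ V]
    [TopologicalSpace V] [AddCommGroup W] [Module ℝ W] [TopologicalSpace W]
    (κ : W [⋀^Fin 2]→L[ℝ] ℝ) (f : V →L[ℝ] W) :
    (cube κ).compContinuousLinearMap f = cube (κ.compContinuousLinearMap f) := by
  rw [cube, cube, wedge_compContinuousLinearMap, wedge_compContinuousLinearMap]

theorem transverseVol_compContinuousLinearMap {V W : Type*} [AddCommGroup V] [Module ℝ V]
    [TopologicalSpace V] [AddCommGroup W] [Module ℝ W] [TopologicalSpace W]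
    (κ : W [⋀^Fin 2]→L[ℝ] ℝ) (f : V →L[ℝ] W) :
    (transverseVol κ).compContinuousLinearMap f =
      transverseVol (κ.compContinuousLinearMap f) := by
  rw [transverseVol, transverseVol, smul_compContinuousLinearMap, cube_compContinuousLinearMap]

theorem cube_stdKahler : cube stdKahler = (6 : ℝ) • idxForm ![1, 2, 3, 4, 5, 6] :=
  wedge_stdKahler_cube

theorem wedge_zero_transverseVol :
    wedge (idxForm ![0]) (transverseVol stdKahler) = stdVol := by
  rw [transverseVol, cube_stdKahler, smul_smul, inv_mul_cancel₀ (by norm_num), one_smul]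
  refine (wedge_idxForm_eq (I := ![0]) (J := ![1, 2, 3, 4, 5, 6]) (K := (id : Fin 7 → Fin 7))
    ?_).trans rfl
  decide

theorem stdStar_wedge_stdKahler_stdKahler :
    stdStar (show 4 + 3 = 7 from rfl) (wedge stdKahler stdKahler) =
      (2 : ℝ) • wedge (idxForm ![0]) stdKahler := by
  have h1 := stdStar_idxForm (show 4 + 3 = 7 from rfl) ![1, 2, 3, 4] ![0, 5, 6] 1
    (by rw [seqSign_seven]; decide) rfl
  have h2 := stdStar_idxForm (show 4 + 3 = 7 from rfl) ![1, 2, 5, 6] ![0, 3, 4] 1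
    (by rw [seqSign_seven]; decide) rfl
  have h3 := stdStar_idxForm (show 4 + 3 = 7 from rfl) ![3, 4, 5, 6] ![0, 1, 2] 1
    (by rw [seqSign_seven]; decide) rfl
  rw [wedge_stdKahler_stdKahler]
  refine (stdStar_smul _ _ _).trans ?_
  rw [stdStar_add, stdStar_add, h1, h2, h3, stdKahler, wedge_add_right, wedge_add_right,
    wedge_idxForm_eq (K := ![0, 1, 2]) (by decide),
    wedge_idxForm_eq (K := ![0, 3, 4]) (by decide),
    wedge_idxForm_eq (K := ![0, 5, 6]) (by decide)]
  ext v
  change 2 * (((1 : ℤ) : ℝ) * _ + ((1 : ℤ) : ℝ) * _ + ((1 : ℤ) : ℝ) * _) = 2 * (_ + _ + _)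
  push_cast
  ring

/-- For every monomial of the G₂-form the increasing complementary indices already give sign +1, so
the coefficients carry over unchanged. -/
theorem stdStar_stdG2Form : stdStar (show 3 + 4 = 7 from rfl) stdG2Form =
    (1 / 2 : ℝ) • wedge stdKahler stdKahler - wedge (idxForm ![0]) stdIm := by
  have h (I : Fin 3 → Fin 7) (K : Fin 4 → Fin 7) (s : ℤ) :=
    stdStar_idxForm (show 3 + 4 = 7 from rfl) I K s
  simp only [stdG2Form, coordForm3_eq, stdStar_sub, stdStar_add]
  rw [h ![0, 1, 2] ![3, 4, 5, 6] 1 (by rw [seqSign_seven]; decide) rfl,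
    h ![0, 3, 4] ![1, 2, 5, 6] 1 (by rw [seqSign_seven]; decide) rfl,
    h ![0, 5, 6] ![1, 2, 3, 4] 1 (by rw [seqSign_seven]; decide) rfl,
    h ![1, 3, 5] ![0, 2, 4, 6] 1 (by rw [seqSign_seven]; decide) rfl,
    h ![1, 4, 6] ![0, 2, 3, 5] 1 (by rw [seqSign_seven]; decide) rfl,
    h ![2, 3, 6] ![0, 1, 4, 5] 1 (by rw [seqSign_seven]; decide) rfl,
    h ![2, 4, 5] ![0, 1, 3, 6] 1 (by rw [seqSign_seven]; decide) rfl,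
    wedge_stdKahler_stdKahler, stdIm, wedge_sub_right, wedge_add_right, wedge_add_right,
    wedge_idxForm_eq (K := ![0, 1, 3, 6]) (by decide),
    wedge_idxForm_eq (K := ![0, 1, 4, 5]) (by decide),
    wedge_idxForm_eq (K := ![0, 2, 3, 5]) (by decide),
    wedge_idxForm_eq (K := ![0, 2, 4, 6]) (by decide)]
  ext v
  change ((1 : ℤ) : ℝ) * _ + ((1 : ℤ) : ℝ) * _ + ((1 : ℤ) : ℝ) * _ + ((1 : ℤ) : ℝ) * _
    - ((1 : ℤ) : ℝ) * _ - ((1 : ℤ) : ℝ) * _ - ((1 : ℤ) : ℝ) * _ =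
    1 / 2 * (2 * (_ + _ + _)) - (_ + _ + _ - _)
  push_cast
  ring

end StdCalabiYau

/-! ### Adapted frames of a tangent space -/

section AdaptedFrame

variable {V : Type*} [AddCommGroup V] [Module ℝ V] [TopologicalSpace V]

/-- The algebraic conditions satisfied at a point by the tensors of a contact Calabi–Yau
7-manifold. -/
structure IsPointwiseCalabiYau (η : V [⋀^Fin 1]→L[ℝ] ℝ) (g : V →L[ℝ] V →L[ℝ] ℝ) (ξ : V)
    (Φ : V →L[ℝ] V) (κ : V [⋀^Fin 2]→L[ℝ] ℝ) (Υ : V [⋀^Fin 3]→L[ℝ] ℂ) : Prop where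
  symm : ∀ X Y, g X Y = g Y X
  pos : ∀ X, X ≠ 0 → 0 < g X X
  η_ξ : η ![ξ] = 1
  Φ_sq : ∀ X, Φ (Φ X) = -X + η ![X] • ξ
  g_Φ : ∀ X Y, g (Φ X) (Φ Y) = g X Y - η ![X] * η ![Y]
  κ_eq : ∀ X Y, κ ![X, Y] = g (Φ X) Y
  Υ_ξ : ∀ X Y, Υ ![ξ, X, Y] = 0
  Υ_type : ∀ X Y Z, Υ ![Φ X, Y, Z] = Complex.I * Υ ![X, Y, Z]
  Υ_norm : ∀ v, wedge Υ ((Complex.conjCLE : ℂ →L[ℝ] ℂ).compContinuousAlternatingMap Υ) v =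
    ((-1) ^ (3 * 4 / 2) * (2 * Complex.I) ^ 3 / (Nat.factorial 3 : ℂ)) *
      ((wedge (wedge κ κ) κ v : ℝ) : ℂ)

namespace IsPointwiseCalabiYau

variable {g : V →L[ℝ] V →L[ℝ] ℝ} {η : V [⋀^Fin 1]→L[ℝ] ℝ} {ξ : V}
    {Φ : V →L[ℝ] V} {κ : V [⋀^Fin 2]→L[ℝ] ℝ} {Υ : V [⋀^Fin 3]→L[ℝ] ℂ}

theorem map_one_smul (η : V [⋀^Fin 1]→L[ℝ] ℝ) (c : ℝ) (X : V) : η ![c • X] = c * η ![X] :=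
  η.vecCons_smul _ c X

/-- Φ²ξ = 0, so applying the formula for Φ² to Φξ gives Φξ = η(Φξ) ξ. Applying Φ once more gives
η(Φξ) Φξ = 0, and either factor being zero suffices. -/
theorem Φ_ξ (h : IsPointwiseCalabiYau η g ξ Φ κ Υ) : Φ ξ = 0 := by
  have h1 : Φ (Φ ξ) = 0 := by rw [h.Φ_sq, h.η_ξ, one_smul, neg_add_cancel]
  have h2 := h.Φ_sq (Φ ξ)
  rw [h1, map_zero] at h2
  have h3 : Φ ξ = η ![Φ ξ] • ξ := by
    rw [eq_comm, neg_add_eq_zero] at h2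
    exact h2
  have h4 : η ![Φ ξ] • Φ ξ = 0 := by
    rw [← map_smul, ← h3, h1]
  rcases smul_eq_zero.1 h4 with h5 | h5
  · rw [h3, h5, zero_smul]
  · exact h5

theorem η_eq (h : IsPointwiseCalabiYau η g ξ Φ κ Υ) (X : V) : η ![X] = g ξ X := by
  have := h.g_Φ ξ X
  rw [h.Φ_ξ, map_zero, h.η_ξ] at this
  simp only [zero_apply, one_mul] at this
  linarith

/-- Compute Φ³X twice: Φ(Φ²X) has no Reeb term because Φξ = 0, while Φ²(ΦX) has Reeb coefficient
η(ΦX). -/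
theorem η_Φ (h : IsPointwiseCalabiYau η g ξ Φ κ Υ) (X : V) : η ![Φ X] = 0 := by
  have h1 := h.Φ_sq (Φ X)
  rw [h.Φ_sq X, map_add, map_neg, map_smul, h.Φ_ξ, smul_zero, add_zero] at h1
  have h2 : η ![Φ X] • ξ = 0 := by simpa using h1.symm
  have h3 := congrArg (fun Y => η ![Y]) h2
  simp only [map_one_smul, h.η_ξ, mul_one] at h3
  rw [h3, h.η_eq, map_zero]

theorem skew (h : IsPointwiseCalabiYau η g ξ Φ κ Υ) (X Y : V) : g (Φ X) Y = -g X (Φ Y) := by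
  have h1 := h.g_Φ (Φ X) Y
  rw [h.η_Φ, h.Φ_sq, map_add, map_neg, map_smul] at h1
  simp only [add_apply, neg_apply, smul_apply, ← h.η_eq, h.η_Φ, smul_eq_mul, mul_zero, zero_mul,
    add_zero, sub_zero] at h1
  linarith

/-- A unitary frame of `ker η`. -/
structure IsUnitaryFrame (g : V →L[ℝ] V →L[ℝ] ℝ) (ξ : V) (Φ : V →L[ℝ] V) (a : Fin 3 → V) :
    Prop where
  orth_ξ : ∀ m, g ξ (a m) = 0
  orthonormal : ∀ m n, g (a m) (a n) = if m = n then 1 else 0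
  orth_Φ : ∀ m n, g (Φ (a m)) (a n) = 0

/-- Fewer linear conditions than dimensions leave a nonzero solution, which is then normalized. -/
theorem exists_unit_orthogonal [FiniteDimensional ℝ V] (h : IsPointwiseCalabiYau η g ξ Φ κ Υ)
    {n : ℕ} (hn : n < Module.finrank ℝ V) (v : Fin n → V) :
    ∃ X : V, g X X = 1 ∧ ∀ i, g (v i) X = 0 := by
  let L : V →ₗ[ℝ] (Fin n → ℝ) := LinearMap.pi fun i => (g (v i)).toLinearMap
  have hL : LinearMap.ker L ≠ ⊥ := LinearMap.ker_ne_bot_of_finrank_lt (by simpa using hn)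
  obtain ⟨X, hX, hX0⟩ := Submodule.exists_mem_ne_zero_of_ne_bot hL
  have hp := h.pos X hX0
  refine ⟨(Real.sqrt (g X X))⁻¹ • X, ?_, fun i => ?_⟩
  · simp only [map_smul, smul_apply, smul_eq_mul]
    have : Real.sqrt (g X X) ≠ 0 := (Real.sqrt_pos.2 hp).ne'
    field_simp
    exact (Real.sq_sqrt hp.le).symm
  · have : g (v i) X = 0 := congrFun (LinearMap.mem_ker.1 hX) i
    rw [map_smul, this, smul_zero]

/-- Hermitian Gram–Schmidt: each new vector is orthogonal to ξ, to the earlier vectors and to their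
images under Φ, at most five conditions in dimension seven. The relations g(ΦX, X) = 0 come from
skewness of Φ. -/
theorem exists_unitaryFrame [FiniteDimensional ℝ V] (h : IsPointwiseCalabiYau η g ξ Φ κ Υ)
    (hV : Module.finrank ℝ V = 7) : ∃ a : Fin 3 → V, IsUnitaryFrame g ξ Φ a := by
  obtain ⟨a, haa, ha⟩ := h.exists_unit_orthogonal (by rw [hV]; norm_num) ![ξ]
  obtain ⟨b, hbb, hb⟩ := h.exists_unit_orthogonal (by rw [hV]; norm_num) ![ξ, a, Φ a]
  obtain ⟨c, hcc, hc⟩ :=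
    h.exists_unit_orthogonal (by rw [hV]; norm_num) ![ξ, a, Φ a, b, Φ b]
  have ha0 : g ξ a = 0 := ha 0
  have hb0 : g ξ b = 0 := hb 0
  have hb1 : g a b = 0 := hb 1
  have hb2 : g (Φ a) b = 0 := hb 2
  have hc0 : g ξ c = 0 := hc 0
  have hc1 : g a c = 0 := hc 1
  have hc2 : g (Φ a) c = 0 := hc 2
  have hc3 : g b c = 0 := hc 3
  have hc4 : g (Φ b) c = 0 := hc 4
  have hself : ∀ X, g (Φ X) X = 0 := fun X => by
    have := h.skew X X
    rw [h.symm X] at this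
    linarith
  have hsw : ∀ {X Y}, g (Φ X) Y = 0 → g (Φ Y) X = 0 := fun {X Y} hXY => by
    rw [h.skew, h.symm, hXY, neg_zero]
  refine ⟨![a, b, c], ⟨fun m => ?_, fun m n => ?_, fun m n => ?_⟩⟩
  · fin_cases m
    exacts [ha0, hb0, hc0]
  · fin_cases m <;> fin_cases n
    exacts [haa, hb1, hc1, (h.symm _ _).trans hb1, hbb, hc3, (h.symm _ _).trans hc1,
      (h.symm _ _).trans hc3, hcc]
  · fin_cases m <;> fin_cases n
    exacts [hself a, hb2, hc2, hsw hb2, hself b, hc4, hsw hc2, hsw hc4, hself c]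

/-- The coordinates defined by a unitary frame, the Reeb direction being rescaled by `r`. -/
def frameMap (g : V →L[ℝ] V →L[ℝ] ℝ) (ξ : V) (Φ : V →L[ℝ] V) (r : ℝ) (a : Fin 3 → V) :
    V →ₗ[ℝ] E7 :=
  (WithLp.linearEquiv 2 ℝ (Fin 7 → ℝ)).symm.toLinearMap ∘ₗ
    LinearMap.pi ![(r • g ξ).toLinearMap, (g (a 0)).toLinearMap, (g (Φ (a 0))).toLinearMap,
      (g (a 1)).toLinearMap, (g (Φ (a 1))).toLinearMap, (g (a 2)).toLinearMap,
      (g (Φ (a 2))).toLinearMap]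

theorem frameMap_apply (r : ℝ) (a : Fin 3 → V) (X : V) (i : Fin 7) :
    frameMap g ξ Φ r a X i = ![r * g ξ X, g (a 0) X, g (Φ (a 0)) X, g (a 1) X, g (Φ (a 1)) X,
      g (a 2) X, g (Φ (a 2)) X] i := by
  fin_cases i <;> rfl

/-- The frame dual to `frameMap`. -/
def frameVec (ξ : V) (Φ : V →L[ℝ] V) (r : ℝ) (a : Fin 3 → V) : Fin 7 → V :=
  ![r⁻¹ • ξ, a 0, Φ (a 0), a 1, Φ (a 1), a 2, Φ (a 2)]

namespace IsUnitaryFrame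

variable {a : Fin 3 → V}

theorem gΦΦ (h : IsPointwiseCalabiYau η g ξ Φ κ Υ) (ha : IsUnitaryFrame g ξ Φ a) (m n : Fin 3) :
    g (Φ (a m)) (Φ (a n)) = if m = n then 1 else 0 := by
  rw [h.g_Φ, h.η_eq, ha.orth_ξ, zero_mul, sub_zero, ha.orthonormal]

theorem gΦ (h : IsPointwiseCalabiYau η g ξ Φ κ Υ) (ha : IsUnitaryFrame g ξ Φ a) (m n : Fin 3) :
    g (a m) (Φ (a n)) = 0 := by
  rw [h.symm, ha.orth_Φ]

theorem frameMap_frameVec (h : IsPointwiseCalabiYau η g ξ Φ κ Υ) (ha : IsUnitaryFrame g ξ Φ a)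
    {r : ℝ} (hr : r ≠ 0) (j : Fin 7) :
    frameMap g ξ Φ r a (frameVec ξ Φ r a j) = stdVec j := by
  have hξξ : g ξ ξ = 1 := by rw [← h.η_eq, h.η_ξ]
  have h1 : ∀ m, g (a m) ξ = 0 := fun m => by rw [h.symm, ha.orth_ξ]
  have h2 : ∀ m, g ξ (Φ (a m)) = 0 := fun m => by rw [← h.η_eq, h.η_Φ]
  have h3 : ∀ m, g (Φ (a m)) ξ = 0 := fun m => by rw [h.symm, h2]
  ext i
  rw [frameMap_apply, stdVec_apply]
  fin_cases j <;> fin_cases i <;>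
    simp [frameVec, hξξ, h1, h2, h3, ha.orth_ξ, ha.orthonormal, ha.orth_Φ, ha.gΦ h, ha.gΦΦ h, hr]

theorem frameMap_bijective [FiniteDimensional ℝ V] (h : IsPointwiseCalabiYau η g ξ Φ κ Υ)
    (hV : Module.finrank ℝ V = 7) (ha : IsUnitaryFrame g ξ Φ a) {r : ℝ} (hr : r ≠ 0) :
    Function.Bijective (frameMap g ξ Φ r a) := by
  have hsurj : Function.Surjective (frameMap g ξ Φ r a) := fun y => by
    refine ⟨∑ j, y j • frameVec ξ Φ r a j, ?_⟩
    rw [map_sum]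
    simp only [map_smul, frameMap_frameVec h ha hr]
    exact (sum_apply_smul_stdVec y).symm
  exact ⟨(LinearMap.injective_iff_surjective_of_finrank_eq_finrank (by simp [hV])).2 hsurj, hsurj⟩

/-- Expansion of a vector in a unitary frame. -/
theorem expansion [FiniteDimensional ℝ V] (h : IsPointwiseCalabiYau η g ξ Φ κ Υ)
    (hV : Module.finrank ℝ V = 7) (ha : IsUnitaryFrame g ξ Φ a) (X : V) :
    X = g ξ X • ξ + ∑ m, (g (a m) X • a m + g (Φ (a m)) X • Φ (a m)) := by
  apply (frameMap_bijective h hV ha one_ne_zero).1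
  have hf := frameMap_frameVec h ha one_ne_zero
  have e0 : frameMap g ξ Φ 1 a ξ = stdVec 0 := by simpa [frameVec] using hf 0
  have e1 : frameMap g ξ Φ 1 a (a 0) = stdVec 1 := hf 1
  have e2 : frameMap g ξ Φ 1 a (Φ (a 0)) = stdVec 2 := hf 2
  have e3 : frameMap g ξ Φ 1 a (a 1) = stdVec 3 := hf 3
  have e4 : frameMap g ξ Φ 1 a (Φ (a 1)) = stdVec 4 := hf 4
  have e5 : frameMap g ξ Φ 1 a (a 2) = stdVec 5 := hf 5
  have e6 : frameMap g ξ Φ 1 a (Φ (a 2)) = stdVec 6 := hf 6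
  simp only [Fin.sum_univ_three, map_add, map_smul, e0, e1, e2, e3, e4, e5, e6]
  conv_lhs => rw [sum_apply_smul_stdVec (frameMap g ξ Φ 1 a X)]
  simp only [frameMap_apply, Fin.sum_univ_seven]
  simp
  abel

end IsUnitaryFrame

end IsPointwiseCalabiYau

end AdaptedFrame

/-! ### The Kähler form and Υ in a unitary coframe. -/

section AdaptedCoframe

variable {V : Type*} [AddCommGroup V] [Module ℝ V] [TopologicalSpace V]

namespace IsPointwiseCalabiYau

variable {g : V →L[ℝ] V →L[ℝ] ℝ} {η : V [⋀^Fin 1]→L[ℝ] ℝ} {ξ : V}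
    {Φ : V →L[ℝ] V} {κ : V [⋀^Fin 2]→L[ℝ] ℝ} {Υ : V [⋀^Fin 3]→L[ℝ] ℂ} {a : Fin 3 → V}

/-- The complex coordinate covectors of a unitary frame. -/
def zCovector (g : V →L[ℝ] V →L[ℝ] ℝ) (Φ : V →L[ℝ] V) (a : Fin 3 → V) (m : Fin 3) :
    V →L[ℝ] ℂ :=
  Complex.ofRealCLM.comp (g (a m)) + (Complex.I • Complex.ofRealCLM).comp (g (Φ (a m)))

theorem zCovector_apply (m : Fin 3) (X : V) :
    zCovector g Φ a m X = (g (a m) X : ℂ) + Complex.I * (g (Φ (a m)) X : ℂ) := rfl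

/-- Only X needs expanding: κ(X, Y) = g(ΦX, Y), and Φ acts on the frame by a ↦ Φa ↦ −a. -/
theorem kahler_apply [FiniteDimensional ℝ V] (h : IsPointwiseCalabiYau η g ξ Φ κ Υ)
    (hV : Module.finrank ℝ V = 7) (ha : IsUnitaryFrame g ξ Φ a) (X Y : V) :
    κ ![X, Y] = ∑ m, (g (a m) X * g (Φ (a m)) Y - g (Φ (a m)) X * g (a m) Y) := by
  rw [h.κ_eq]
  conv_lhs => rw [ha.expansion h hV X]
  have h1 : ∀ m, Φ (Φ (a m)) = -a m := fun m => by
    rw [h.Φ_sq, h.η_eq, ha.orth_ξ, zero_smul, add_zero]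
  simp only [map_add, map_smul, map_sum, h.Φ_ξ, h1, smul_zero, zero_add, map_neg, sum_apply,
    add_apply, smul_apply, neg_apply, smul_eq_mul]
  exact Finset.sum_congr rfl fun m _ => by ring

/-- A 3-cycle is even. This moves any slot to the first one, where `Υ_ξ` and `Υ_type` apply. -/
theorem Υ_cycle (Υ : V [⋀^Fin 3]→L[ℝ] ℂ) (X Y Z : V) : Υ ![X, Y, Z] = Υ ![Y, Z, X] := by
  have h := Υ.toAlternatingMap.map_perm ![X, Y, Z] (finRotate 3)
  rw [sign_finRotate] at h
  have h2 : ![X, Y, Z] ∘ finRotate 3 = ![Y, Z, X] := by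
    funext i; fin_cases i <;> rfl
  rw [h2] at h
  simpa using h.symm

/-- Since Υ kills ξ and Υ(Φa, ·, ·) = i Υ(a, ·, ·), it is complex linear in its first slot on ker η,
so the real expansion of X collapses to complex coordinates. -/
theorem Υ_expand [FiniteDimensional ℝ V] (h : IsPointwiseCalabiYau η g ξ Φ κ Υ)
    (hV : Module.finrank ℝ V = 7) (ha : IsUnitaryFrame g ξ Φ a) (X Y Z : V) :
    Υ ![X, Y, Z] = ∑ m, zCovector g Φ a m X * Υ ![a m, Y, Z] := by
  let L : V →ₗ[ℝ] ℂ :=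
    { toFun := fun x => Υ ![x, Y, Z]
      map_add' := fun x y => Υ.vecCons_add _ x y
      map_smul' := fun c x => Υ.vecCons_smul _ c x }
  have hL : ∀ x, Υ ![x, Y, Z] = L x := fun _ => rfl
  rw [hL]
  conv_lhs => rw [ha.expansion h hV X]
  simp only [map_add, map_smul, map_sum]
  simp only [L, LinearMap.coe_mk, AddHom.coe_mk, h.Υ_ξ, h.Υ_type, smul_zero, zero_add,
    zCovector_apply, Complex.real_smul]
  exact Finset.sum_congr rfl fun m _ => by ring

/-- The complex coframe of a unitary frame, with the first covector rescaled by `c`. -/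
def zCoframe (g : V →L[ℝ] V →L[ℝ] ℝ) (Φ : V →L[ℝ] V) (a : Fin 3 → V) (c : ℂ) :
    Fin 3 → V →L[ℝ] ℂ :=
  ![c • zCovector g Φ a 0, zCovector g Φ a 1, zCovector g Φ a 2]

/-- An alternating complex trilinear form on a complex 3-space is a multiple of the determinant; the
multiple is the value on the frame, absorbed into the first covector. -/
theorem Υ_eq_detForm [FiniteDimensional ℝ V] (h : IsPointwiseCalabiYau η g ξ Φ κ Υ)
    (hV : Module.finrank ℝ V = 7) (ha : IsUnitaryFrame g ξ Φ a) :
    Υ = detForm (zCoframe g Φ a (Υ ![a 0, a 1, a 2])) := by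
  ext v
  have hv : v = ![v 0, v 1, v 2] := by funext i; fin_cases i <;> rfl
  conv_lhs => rw [hv]
  have hexp : ∀ X Y Z, Υ ![X, Y, Z] = ∑ m, ∑ n, ∑ p, zCovector g Φ a m X * (zCovector g Φ a n Y *
      (zCovector g Φ a p Z * Υ ![a p, a m, a n])) := by
    intro X Y Z
    rw [Υ_expand h hV ha]
    refine Finset.sum_congr rfl fun m _ => ?_
    rw [Υ_cycle, Υ_expand h hV ha, Finset.mul_sum]
    refine Finset.sum_congr rfl fun n _ => ?_
    rw [Υ_cycle, Υ_expand h hV ha, Finset.mul_sum, Finset.mul_sum]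
  have h01 : ∀ X Y, Υ ![X, X, Y] = 0 := fun X Y =>
    Υ.map_eq_zero_of_eq _ (i := 0) (j := 1) rfl (by decide)
  have h02 : ∀ X Y, Υ ![X, Y, X] = 0 := fun X Y =>
    Υ.map_eq_zero_of_eq _ (i := 0) (j := 2) rfl (by decide)
  have h12 : ∀ X Y, Υ ![Y, X, X] = 0 := fun X Y =>
    Υ.map_eq_zero_of_eq _ (i := 1) (j := 2) rfl (by decide)
  have c1 : Υ ![a 2, a 0, a 1] = Υ ![a 0, a 1, a 2] := Υ_cycle _ _ _ _
  have c2 : Υ ![a 1, a 2, a 0] = Υ ![a 0, a 1, a 2] := (Υ_cycle _ _ _ _).symm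
  have c3 : Υ ![a 1, a 0, a 2] = -Υ ![a 0, a 1, a 2] := by
    have := Υ.toAlternatingMap.map_swap ![a 0, a 1, a 2] (i := 0) (j := 1) (by decide)
    rw [show ![a 0, a 1, a 2] ∘ Equiv.swap (0 : Fin 3) 1 = ![a 1, a 0, a 2] by
      funext i; fin_cases i <;> rfl] at this
    exact this
  have c4 : Υ ![a 0, a 2, a 1] = -Υ ![a 0, a 1, a 2] := by
    rw [← c3, Υ_cycle, Υ_cycle]
  have c5 : Υ ![a 2, a 1, a 0] = -Υ ![a 0, a 1, a 2] := by
    rw [← c3, Υ_cycle]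
  rw [hexp]
  simp only [Fin.sum_univ_three, h01, h02, h12, c1, c2, c3, c4, c5, detForm_apply,
    Matrix.det_fin_three, Matrix.of_apply, zCoframe]
  simp
  ring

theorem Υ_eq_detForm_of_adapted [FiniteDimensional ℝ V] (h : IsPointwiseCalabiYau η g ξ Φ κ Υ)
    (hV : Module.finrank ℝ V = 7) (ha : IsUnitaryFrame g ξ Φ a) (h1 : Υ ![a 0, a 1, a 2] = 1)
    (v : Fin 3 → V) :
    Υ v = Matrix.det (Matrix.of fun i j => zCovector g Φ a j (v i)) := by
  conv_lhs => rw [Υ_eq_detForm h hV ha, h1, detForm_apply]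
  congr 2
  funext i j
  fin_cases j <;> simp [zCoframe]

/-- The real frame underlying a unitary frame. -/
def realFrame (Φ : V →L[ℝ] V) (a : Fin 3 → V) : Fin 6 → V :=
  ![a 0, Φ (a 0), a 1, Φ (a 1), a 2, Φ (a 2)]

/-- Each dz∧dz̄ takes the value −2i on a pair (a, Φa), and sorting dz¹dz²dz³dz̄¹dz̄²dz̄³ into such
pairs is odd: −(−2i)³ = −8i. -/
theorem wedge_conj_detForm_apply (h : IsPointwiseCalabiYau η g ξ Φ κ Υ) (ha : IsUnitaryFrame g ξ Φ a)
    (c : ℂ) :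
    wedge (k := 3) (l := 3) (detForm (zCoframe g Φ a c))
      ((Complex.conjCLE : ℂ →L[ℝ] ℂ).compContinuousAlternatingMap
        (detForm (zCoframe g Φ a c)))
      (realFrame Φ a) =
      -8 * Complex.I * (c * (starRingEnd ℂ) c) := by
  have hconj : (Complex.conjCLE : ℂ →L[ℝ] ℂ).compContinuousAlternatingMap
      (detForm (zCoframe g Φ a c)) =
      detForm fun m => (Complex.conjCLE : ℂ →L[ℝ] ℂ).comp
        (zCoframe g Φ a c m) := by
    ext w
    exact RingHom.map_det (starRingEnd ℂ) _
  rw [hconj, wedge_detForm, detForm_apply]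
  have hM : (Matrix.of fun i j => (Fin.append (zCoframe g Φ a c) fun m => (Complex.conjCLE : ℂ →L[ℝ] ℂ).comp
        (zCoframe g Φ a c m)) j
        (realFrame Φ a i)) =
      !![c, 0, 0, (starRingEnd ℂ) c, 0, 0;
        Complex.I * c, 0, 0, -Complex.I * (starRingEnd ℂ) c, 0, 0;
        0, 1, 0, 0, 1, 0;
        0, Complex.I, 0, 0, -Complex.I, 0;
        0, 0, 1, 0, 0, 1;
        0, 0, Complex.I, 0, 0, -Complex.I] := by
    ext i j
    fin_cases i <;> fin_cases j <;>
      simp [zCoframe, realFrame, Fin.append, Fin.addCases, zCovector_apply, ha.orthonormal, ha.orth_Φ, ha.gΦ h, ha.gΦΦ h]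
    all_goals exact mul_comm _ _
  refine (congrArg Matrix.det hM).trans ?_
  simp [Matrix.det_succ_row_zero, Fin.sum_univ_succ, Fin.succAbove]
  have hI : Complex.I * (-Complex.I + -Complex.I) = 2 := by
    linear_combination (-2 : ℂ) * Complex.I_mul_I
  rw [hI]
  ring

end IsPointwiseCalabiYau

end AdaptedCoframe

/-! ### The adapted isomorphism with ℝ ⊕ ℂ³. -/

section AdaptedEquiv

variable {V : Type*} [AddCommGroup V] [Module ℝ V] [TopologicalSpace V]
  [IsTopologicalAddGroup V] [ContinuousSMul ℝ V] [T2Space V] [FiniteDimensional ℝ V]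

namespace IsPointwiseCalabiYau

variable {g : V →L[ℝ] V →L[ℝ] ℝ} {η : V [⋀^Fin 1]→L[ℝ] ℝ} {ξ : V}
    {Φ : V →L[ℝ] V} {κ : V [⋀^Fin 2]→L[ℝ] ℝ} {Υ : V [⋀^Fin 3]→L[ℝ] ℂ} {a : Fin 3 → V}

/-- The isomorphism with `ℝ⁷` defined by a unitary frame. -/
def frameEquiv (h : IsPointwiseCalabiYau η g ξ Φ κ Υ) (hV : Module.finrank ℝ V = 7)
    (ha : IsUnitaryFrame g ξ Φ a) {r : ℝ} (hr : r ≠ 0) : V ≃L[ℝ] E7 :=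
  (LinearEquiv.ofBijective (frameMap g ξ Φ r a)
    (ha.frameMap_bijective h hV hr)).toContinuousLinearEquiv

section

variable (h : IsPointwiseCalabiYau η g ξ Φ κ Υ) (hV : Module.finrank ℝ V = 7)
  (ha : IsUnitaryFrame g ξ Φ a) {r : ℝ} (hr : r ≠ 0)

theorem frameEquiv_apply (X : V) (i : Fin 7) :
    (frameEquiv h hV ha hr : V →L[ℝ] E7) X i = ![r * g ξ X, g (a 0) X, g (Φ (a 0)) X, g (a 1) X,
      g (Φ (a 1)) X, g (a 2) X, g (Φ (a 2)) X] i :=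
  frameMap_apply r a X i

theorem frameEquiv_frameVec (j : Fin 7) :
    (frameEquiv h hV ha hr : V →L[ℝ] E7) (frameVec ξ Φ r a j) = stdVec j :=
  ha.frameMap_frameVec h hr j

theorem η_eq_pullback : r • η =
    (idxForm ![0]).compContinuousLinearMap (frameEquiv h hV ha hr : V →L[ℝ] E7) := by
  ext v
  have hv : v = ![v 0] := by funext i; fin_cases i; rfl
  conv_lhs => rw [hv]
  rw [ContinuousAlternatingMap.smul_apply, h.η_eq,
    ContinuousAlternatingMap.compContinuousLinearMap_apply, idxForm_apply, Matrix.det_fin_one]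
  exact (frameEquiv_apply h hV ha hr (v 0) 0).symm

theorem κ_eq_pullback : κ =
    stdKahler.compContinuousLinearMap (frameEquiv h hV ha hr : V →L[ℝ] E7) := by
  ext v
  have hv : v = ![v 0, v 1] := by funext i; fin_cases i <;> rfl
  conv_lhs => rw [hv]
  rw [kahler_apply h hV ha, Fin.sum_univ_three]
  simp only [ContinuousAlternatingMap.compContinuousLinearMap_apply, stdKahler,
    ContinuousAlternatingMap.add_apply, idxForm_apply, Matrix.det_fin_two, Matrix.of_apply,
    Function.comp_apply, frameEquiv_apply]
  simp

/-- The first coordinate is r η, which gives the Reeb term; the other six give Parseval's identity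
for g on ker η. -/
theorem pullbackBilin_frameEquiv (X Y : V) :
    pullbackBilin stdInner (frameEquiv h hV ha hr : V →L[ℝ] E7) X Y =
      r ^ 2 * (η ![X] * η ![Y]) + g (X - η ![X] • ξ) (Y - η ![Y] • ξ) := by
  have h1 : ∀ m, g (a m) ξ = 0 := fun m => by rw [h.symm, ha.orth_ξ]
  have h3 : ∀ m, g (Φ (a m)) ξ = 0 := fun m => by rw [h.symm, ← h.η_eq, h.η_Φ]
  have hX : X - η ![X] • ξ = ∑ m, (g (a m) X • a m + g (Φ (a m)) X • Φ (a m)) := by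
    rw [h.η_eq, sub_eq_iff_eq_add']
    exact ha.expansion h hV X
  rw [hX, pullbackBilin_apply, stdInner_apply]
  simp only [frameEquiv_apply, Fin.sum_univ_seven, Fin.sum_univ_three, map_add, map_smul, map_sub,
    add_apply, smul_apply, h1, h3, smul_eq_mul, h.η_eq]
  simp
  ring

end

theorem κ_cube_frame (h : IsPointwiseCalabiYau η g ξ Φ κ Υ) (hV : Module.finrank ℝ V = 7)
    (ha : IsUnitaryFrame g ξ Φ a) :
    wedge (wedge κ κ) κ (realFrame Φ a) = 6 := by
  have hκ := κ_eq_pullback h hV ha (one_ne_zero (α := ℝ))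
  have h3 : wedge (wedge κ κ) κ =
      (wedge (wedge stdKahler stdKahler) stdKahler).compContinuousLinearMap
      (frameEquiv h hV ha one_ne_zero : V →L[ℝ] E7) := by
    rw [wedge_compContinuousLinearMap, wedge_compContinuousLinearMap, ← hκ]
  rw [h3, wedge_stdKahler_cube]
  have hv : (fun i => (frameEquiv h hV ha one_ne_zero : V →L[ℝ] E7)
      (realFrame Φ a i)) = fun i => stdVec i.succ := by
    funext i
    rw [← frameEquiv_frameVec h hV ha (one_ne_zero (α := ℝ))]
    congr 1
  change (6 : ℝ) * idxForm _ (fun i => (frameEquiv h hV ha one_ne_zero : V →L[ℝ] E7)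
      (realFrame Φ a i)) = 6
  rw [hv, idxForm_apply]
  have hM : (Matrix.of fun i j => stdVec (Fin.succ i) (![1, 2, 3, 4, 5, 6] j)) =
      (1 : Matrix (Fin 6) (Fin 6) ℝ) := by
    ext i j
    have hj : (![1, 2, 3, 4, 5, 6] : Fin 6 → Fin 7) j = j.succ := by fin_cases j <;> rfl
    simp [hj, stdVec_apply, Matrix.one_apply, eq_comm]
  refine (congrArg (fun d : ℝ => 6 * d) (congrArg Matrix.det hM)).trans ?_
  rw [Matrix.det_one, mul_one]

/-- Evaluate the normalization of Υ on the real frame: the left side is −8i|c|², and the right side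
is (2i)³/6 times ω³ = 6, that is −8i. -/
theorem norm_Υ_frame (h : IsPointwiseCalabiYau η g ξ Φ κ Υ) (hV : Module.finrank ℝ V = 7)
    (ha : IsUnitaryFrame g ξ Φ a) :
    Υ ![a 0, a 1, a 2] * (starRingEnd ℂ) (Υ ![a 0, a 1, a 2]) = 1 := by
  have h2 := wedge_conj_detForm_apply h ha (Υ ![a 0, a 1, a 2])
  rw [← Υ_eq_detForm h hV ha] at h2
  have h3 := h2.symm.trans (h.Υ_norm (realFrame Φ a))
  rw [κ_cube_frame h hV ha] at h3
  have hI : (-8 : ℂ) * Complex.I ≠ 0 := by simp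
  apply mul_left_cancel₀ hI
  refine h3.trans ?_
  norm_num [Nat.factorial]
  linear_combination (8 * Complex.I) * Complex.I_mul_I

theorem exists_adaptedFrame (h : IsPointwiseCalabiYau η g ξ Φ κ Υ)
    (hV : Module.finrank ℝ V = 7) :
    ∃ a : Fin 3 → V, IsUnitaryFrame g ξ Φ a ∧ Υ ![a 0, a 1, a 2] = 1 := by
  obtain ⟨a, ha⟩ := h.exists_unitaryFrame hV
  set c := Υ ![a 0, a 1, a 2] with hc
  have hcc : c * (starRingEnd ℂ) c = 1 := norm_Υ_frame h hV ha
  have hc2 : c.re * c.re + c.im * c.im = 1 := by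
    have := congrArg Complex.re hcc
    simpa using this
  have hΦΦ : ∀ m, Φ (Φ (a m)) = -a m := fun m => by
    rw [h.Φ_sq, h.η_eq, ha.orth_ξ, zero_smul, add_zero]
  have hξΦ : ∀ m, g ξ (Φ (a m)) = 0 := fun m => by rw [← h.η_eq, h.η_Φ]
  -- Multiply the first frame vector by the conjugate of the phase c, with Φ acting as i; by complex
  -- linearity Υ becomes c̄c = 1 on the new frame.
  refine ⟨![c.re • a 0 - c.im • Φ (a 0), a 1, a 2],
    ⟨fun m => ?_, fun m n => ?_, fun m n => ?_⟩, ?_⟩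
  · fin_cases m <;> simp [ha.orth_ξ, hξΦ]
  · fin_cases m <;> fin_cases n <;>
      simp [ha.orthonormal, ha.orth_Φ, ha.gΦ h, ha.gΦΦ h]
    linarith
  · fin_cases m <;> fin_cases n <;>
      simp [ha.orthonormal, ha.orth_Φ, ha.gΦ h, ha.gΦΦ h, hΦΦ]
    ring
  · let L : V →ₗ[ℝ] ℂ :=
      { toFun := fun x => Υ ![x, a 1, a 2]
        map_add' := fun x y => Υ.vecCons_add _ x y
        map_smul' := fun c x => Υ.vecCons_smul _ c x }
    change L (c.re • a 0 - c.im • Φ (a 0)) = 1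
    rw [map_sub, map_smul, map_smul]
    change c.re • Υ ![a 0, a 1, a 2] - c.im • Υ ![Φ (a 0), a 1, a 2] = 1
    rw [h.Υ_type, ← hc]
    refine Eq.trans ?_ hcc
    apply Complex.ext
    · simp
    · simp; ring

/-- In a suitable coframe, the tensors of a contact Calabi–Yau manifold at a point are the
standard ones. -/
theorem exists_adaptedEquiv (h : IsPointwiseCalabiYau η g ξ Φ κ Υ)
    (hV : Module.finrank ℝ V = 7) {r : ℝ} (hr : r ≠ 0) :
    ∃ u : V ≃L[ℝ] E7,
      r • η = (idxForm ![0]).compContinuousLinearMap (u : V →L[ℝ] E7) ∧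
      κ = stdKahler.compContinuousLinearMap (u : V →L[ℝ] E7) ∧
      Complex.reCLM.compContinuousAlternatingMap Υ =
        stdRe.compContinuousLinearMap (u : V →L[ℝ] E7) ∧
      Complex.imCLM.compContinuousAlternatingMap Υ =
        stdIm.compContinuousLinearMap (u : V →L[ℝ] E7) ∧
      ∀ X Y, pullbackBilin stdInner (u : V →L[ℝ] E7) X Y =
        r ^ 2 * (η ![X] * η ![Y]) + g (X - η ![X] • ξ) (Y - η ![Y] • ξ) := by
  obtain ⟨a, ha, h1⟩ := h.exists_adaptedFrame hV
  refine ⟨frameEquiv h hV ha hr, η_eq_pullback h hV ha hr, κ_eq_pullback h hV ha hr, ?_, ?_,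
    pullbackBilin_frameEquiv h hV ha hr⟩
  · ext v
    change Complex.re (Υ v) = _
    rw [Υ_eq_detForm_of_adapted h hV ha h1]
    simp only [ContinuousAlternatingMap.compContinuousLinearMap_apply, stdRe,
      ContinuousAlternatingMap.sub_apply, idxForm_apply, Matrix.det_fin_three, Matrix.of_apply,
      Function.comp_apply, frameEquiv_apply, zCovector_apply]
    simp
    ring
  · ext v
    change Complex.im (Υ v) = _
    rw [Υ_eq_detForm_of_adapted h hV ha h1]
    simp only [ContinuousAlternatingMap.compContinuousLinearMap_apply, stdIm,
      ContinuousAlternatingMap.sub_apply, ContinuousAlternatingMap.add_apply, idxForm_apply,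
      Matrix.det_fin_three, Matrix.of_apply,
      Function.comp_apply, frameEquiv_apply, zCovector_apply]
    simp
    ring

end IsPointwiseCalabiYau

end AdaptedEquiv

/-! ### The G₂-form r η∧κ + Re Υ at a point. -/

section PointwiseG2

variable {V : Type*} [AddCommGroup V] [Module ℝ V] [TopologicalSpace V]
  [IsTopologicalAddGroup V] [ContinuousSMul ℝ V] [T2Space V] [FiniteDimensional ℝ V]

namespace IsPointwiseCalabiYau

variable {g : V →L[ℝ] V →L[ℝ] ℝ} {η : V [⋀^Fin 1]→L[ℝ] ℝ} {ξ : V}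
    {Φ : V →L[ℝ] V} {κ : V [⋀^Fin 2]→L[ℝ] ℝ} {Υ : V [⋀^Fin 3]→L[ℝ] ℂ}

/-- The `G₂`-form `r η ∧ κ + Re Υ`. -/
def g2Form (η : V [⋀^Fin 1]→L[ℝ] ℝ) (κ : V [⋀^Fin 2]→L[ℝ] ℝ) (Υ : V [⋀^Fin 3]→L[ℝ] ℂ) (r : ℝ) :
    V [⋀^Fin 3]→L[ℝ] ℝ :=
  r • wedge η κ + Complex.reCLM.compContinuousAlternatingMap Υ

/-- One isomorphism u brings r η, κ, Re Υ and Im Υ to standard form at once, and wedge, star and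
associated pair commute with it. Each clause is therefore the pullback of an identity on ℝ⁷, with r
entering only through r η. -/
theorem g2Form_properties (h : IsPointwiseCalabiYau η g ξ Φ κ Υ)
    (hV : Module.finrank ℝ V = 7) {r : ℝ} (hr : r ≠ 0) :
    ∃ u : V ≃L[ℝ] E7,
      g2Form η κ Υ r = stdG2Form.compContinuousLinearMap (u : V →L[ℝ] E7) ∧
      associatedPair (g2Form η κ Υ r) = (pullbackBilin stdInner (u : V →L[ℝ] E7),
        stdVol.compContinuousLinearMap (u : V →L[ℝ] E7)) ∧
      (∀ X Y, pullbackBilin stdInner (u : V →L[ℝ] E7) X Y =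
        r ^ 2 * (η ![X] * η ![Y]) + g (X - η ![X] • ξ) (Y - η ![Y] • ξ)) ∧
      stdVol.compContinuousLinearMap (u : V →L[ℝ] E7) =
        r • wedge η (transverseVol κ) ∧
      hodgeStar 3 4 rfl (pullbackBilin stdInner (u : V →L[ℝ] E7))
        (stdVol.compContinuousLinearMap (u : V →L[ℝ] E7)) (g2Form η κ Υ r) =
        (1 / 2 : ℝ) • wedge κ κ - r • wedge η (Complex.imCLM.compContinuousAlternatingMap Υ) ∧
      hodgeStar 4 3 rfl (pullbackBilin stdInner (u : V →L[ℝ] E7))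
        (stdVol.compContinuousLinearMap (u : V →L[ℝ] E7)) (wedge κ κ) = (2 * r) • wedge η κ ∧
      wedge κ (Complex.imCLM.compContinuousAlternatingMap Υ) = 0 := by
  obtain ⟨u, hη, hκ, hre, him, hg⟩ := h.exists_adaptedEquiv hV hr
  have hφ : g2Form η κ Υ r = stdG2Form.compContinuousLinearMap (u : V →L[ℝ] E7) := by
    rw [g2Form, ← wedge_smul_left, hη, hre, stdG2Form_eq]
    conv_lhs => rw [hκ]
    rw [← wedge_compContinuousLinearMap]
    rfl
  have hκκ : wedge κ κ =
      (wedge stdKahler stdKahler).compContinuousLinearMap (u : V →L[ℝ] E7) := by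
    rw [wedge_compContinuousLinearMap, ← hκ]
  have hη' : ∀ {l : ℕ} (β : E7 [⋀^Fin l]→L[ℝ] ℝ),
      r • wedge η (β.compContinuousLinearMap (u : V →L[ℝ] E7)) =
        (wedge (idxForm ![0]) β).compContinuousLinearMap (u : V →L[ℝ] E7) := fun β => by
    rw [← wedge_smul_left, hη, ← wedge_compContinuousLinearMap]
  refine ⟨u, hφ, ?_, hg, ?_, ?_, ?_, ?_⟩
  · rw [hφ, associatedPair_pullback_std]
  · refine (congrArg (fun α => α.compContinuousLinearMap (u : V →L[ℝ] E7))
      wedge_zero_transverseVol.symm).trans ?_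
    refine (hη' _).symm.trans ?_
    rw [transverseVol_compContinuousLinearMap, ← hκ]
  · rw [hφ]
    refine (hodgeStar_pullback_stdVol _ u _).trans ?_
    refine (congrArg (fun α => α.compContinuousLinearMap (u : V →L[ℝ] E7))
      stdStar_stdG2Form).trans ?_
    rw [hκκ, him, hη']
    rfl
  · rw [hκκ]
    refine (hodgeStar_pullback_stdVol _ u _).trans ?_
    refine (congrArg (fun α => α.compContinuousLinearMap (u : V →L[ℝ] E7))
      stdStar_wedge_stdKahler_stdKahler).trans ?_
    rw [mul_smul]
    conv_rhs => rw [hκ, hη']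
    rfl
  · rw [him]
    conv_lhs => rw [hκ, ← wedge_compContinuousLinearMap, wedge_stdKahler_stdIm]
    rfl

end IsPointwiseCalabiYau

end PointwiseG2

/-! ### The Leibniz rule for the exterior derivative on `ℝ⁷` -/

section Leibniz

open ContinuousAlternatingMap (alternatizeUncurryFin alternatizeUncurryFin_apply)

section Bilinear

variable {V : Type*} [NormedAddCommGroup V] [NormedSpace ℝ V]
  {A : Type*} [NormedCommRing A] [NormedAlgebra ℝ A]

/-- A crude bound, there to make the wedge product a continuous bilinear map that can be
differentiated. -/
theorem norm_wedge_le {k l : ℕ} (α : V [⋀^Fin k]→L[ℝ] A) (β : V [⋀^Fin l]→L[ℝ] A) :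
    ‖wedge α β‖ ≤ (k.factorial * l.factorial : ℝ)⁻¹ *
      Fintype.card (Equiv.Perm (Fin (k + l))) * ‖α‖ * ‖β‖ := by
  refine ContinuousAlternatingMap.opNorm_le_bound _ (by positivity) fun v => ?_
  have hσ : ∀ σ : Equiv.Perm (Fin (k + l)), ‖Equiv.Perm.sign σ •
      (α (fun i => v (σ (Fin.castAdd l i))) * β (fun i => v (σ (Fin.natAdd k i))))‖ ≤
      ‖α‖ * ‖β‖ * ∏ i, ‖v i‖ := fun σ => by
    have h1 : ∀ (s : ℤˣ) (a : A), ‖s • a‖ = ‖a‖ := fun s a => by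
      rcases Int.units_eq_one_or s with rfl | rfl <;> simp
    rw [h1]
    refine (norm_mul_le _ _).trans ?_
    refine (mul_le_mul (α.le_opNorm _) (β.le_opNorm _) (norm_nonneg _) (by positivity)).trans ?_
    rw [← Equiv.prod_comp σ (fun i => ‖v i‖), Fin.prod_univ_add]
    apply le_of_eq
    ring
  rw [wedge_apply, norm_smul, Real.norm_of_nonneg (by positivity)]
  refine (mul_le_mul_of_nonneg_left (norm_sum_le_of_le _ fun σ _ => hσ σ) (by positivity)).trans ?_
  rw [Finset.sum_const, nsmul_eq_mul, Finset.card_univ]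
  apply le_of_eq
  ring

variable (V A) in
/-- The wedge product as a continuous bilinear map. -/
def wedgeL (k l : ℕ) :
    (V [⋀^Fin k]→L[ℝ] A) →L[ℝ] (V [⋀^Fin l]→L[ℝ] A) →L[ℝ] V [⋀^Fin (k + l)]→L[ℝ] A :=
  LinearMap.mkContinuous₂ (LinearMap.mk₂ ℝ wedge wedge_add_left wedge_smul_left wedge_add_right
    wedge_smul_right) _ norm_wedge_le

end Bilinear

theorem idxForm_cast {k l : ℕ} (h : k = l) (I : Fin l → Fin 7) (v : Fin k → E7) :
    idxForm (I ∘ Fin.cast h) v = idxForm I (v ∘ Fin.cast h.symm) := by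
  subst h
  rfl

/-- After expanding `idxForm I` as a determinant, each permutation σ contributes α v once, since its
sign cancels against the alternation of α. This happens k! times. -/
theorem form_eq_sum_idxForm {k : ℕ} (α : E7 [⋀^Fin k]→L[ℝ] ℝ) :
    α = (k.factorial : ℝ)⁻¹ • ∑ I : Fin k → Fin 7, α (stdVec ∘ I) • idxForm I := by
  have hexp : ∀ v : Fin k → E7,
      α v = ∑ I : Fin k → Fin 7, (∏ j, v j (I j)) * α (stdVec ∘ I) := fun v => by
    conv_lhs => rw [show v = fun j => ∑ i, v j i • stdVec i from
      funext fun j => sum_apply_smul_stdVec (v j)]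
    refine (α.toMultilinearMap.map_sum (fun j i => v j i • stdVec i)).trans ?_
    refine Finset.sum_congr rfl fun I _ => ?_
    exact α.toMultilinearMap.map_smul_univ (fun j => v j (I j)) (fun j => stdVec (I j))
  ext v
  have h1 : ∀ I : Fin k → Fin 7, (α (stdVec ∘ I) • idxForm I) v =
      ∑ σ : Equiv.Perm (Fin k), (Equiv.Perm.sign σ : ℝ) *
        ((∏ j, v (σ j) (I j)) * α (stdVec ∘ I)) := fun I => by
    rw [ContinuousAlternatingMap.smul_apply, idxForm_apply, Matrix.det_apply', smul_eq_mul,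
      Finset.mul_sum]
    refine Finset.sum_congr rfl fun σ _ => ?_
    simp only [Matrix.of_apply]
    ring
  have h2 : ∀ σ : Equiv.Perm (Fin k),
      ∑ I : Fin k → Fin 7, (Equiv.Perm.sign σ : ℝ) * ((∏ j, v (σ j) (I j)) * α (stdVec ∘ I)) =
        α v := fun σ => by
    have h3 := hexp (v ∘ σ)
    simp only [Function.comp_apply] at h3
    have h4 : α (v ∘ σ) = Equiv.Perm.sign σ • α v := α.toAlternatingMap.map_perm v σ
    rw [← Finset.mul_sum, ← h3, h4]
    rcases Int.units_eq_one_or (Equiv.Perm.sign σ) with h | h <;> simp [h]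
  rw [ContinuousAlternatingMap.smul_apply, ContinuousAlternatingMap.sum_apply,
    Finset.sum_congr rfl fun I _ => h1 I, Finset.sum_comm, Finset.sum_congr rfl fun σ _ => h2 σ,
    Finset.sum_const, Finset.card_univ, Fintype.card_perm, Fintype.card_fin, nsmul_eq_mul,
    smul_eq_mul, inv_mul_cancel_left₀ (by positivity)]

theorem span_idxForm (k : ℕ) :
    Submodule.span ℝ (range (idxForm : (Fin k → Fin 7) → E7 [⋀^Fin k]→L[ℝ] ℝ)) = ⊤ := by
  refine eq_top_iff.2 fun α _ => ?_
  rw [form_eq_sum_idxForm α]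
  exact Submodule.smul_mem _ _ (Submodule.sum_mem _ fun I _ =>
    Submodule.smul_mem _ _ (Submodule.subset_span ⟨I, rfl⟩))

/-- The form-valued 1-form `dx^p ⊗ dx^I`. -/
def tensorForm {k : ℕ} (p : Fin 7) (I : Fin k → Fin 7) : E7 →L[ℝ] E7 [⋀^Fin k]→L[ℝ] ℝ :=
  (EuclideanSpace.proj p : E7 →L[ℝ] ℝ).smulRight (idxForm I)

theorem span_tensorForm (k : ℕ) :
    Submodule.span ℝ (range fun p : Fin 7 × (Fin k → Fin 7) => tensorForm p.1 p.2) = ⊤ := by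
  refine eq_top_iff.2 fun B _ => ?_
  have hB : B = ∑ p, (EuclideanSpace.proj p : E7 →L[ℝ] ℝ).smulRight (B (stdVec p)) := by
    ext1 x
    conv_lhs => rw [sum_apply_smul_stdVec x]
    rw [map_sum, sum_apply]
    refine Finset.sum_congr rfl fun p _ => ?_
    rw [map_smul]
    rfl
  rw [hB]
  refine Submodule.sum_mem _ fun p _ => ?_
  have hle : Submodule.span ℝ (range idxForm) ≤ (Submodule.span ℝ (range
      fun p : Fin 7 × (Fin k → Fin 7) => tensorForm p.1 p.2)).comap
        (ContinuousLinearMap.smulRightL ℝ E7 _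
          (EuclideanSpace.proj p : E7 →L[ℝ] ℝ)).toLinearMap := by
    rw [Submodule.span_le]
    rintro _ ⟨I, rfl⟩
    exact Submodule.subset_span ⟨(p, I), rfl⟩
  exact hle (by rw [span_idxForm]; trivial)

/-- The alternation formula is the Laplace expansion of the determinant along its first column, the
one belonging to p. -/
theorem alternatizeUncurryFin_tensorForm {k : ℕ} (p : Fin 7) (I : Fin k → Fin 7) :
    alternatizeUncurryFin (tensorForm p I) = idxForm (Fin.cons p I : Fin (k + 1) → Fin 7) := by
  ext v
  rw [alternatizeUncurryFin_apply, idxForm_apply, Matrix.det_succ_column_zero]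
  refine Finset.sum_congr rfl fun i _ => ?_
  rw [tensorForm, ContinuousLinearMap.smulRight_apply, ContinuousAlternatingMap.smul_apply,
    idxForm_apply, zsmul_eq_mul, smul_eq_mul, ← mul_assoc]
  push_cast
  rfl

theorem wedge_tensorForm_left {k l : ℕ} (p : Fin 7) (I : Fin k → Fin 7) (J : Fin l → Fin 7) :
    ((wedgeL E7 ℝ k l).flip (idxForm J)).comp (tensorForm p I) =
      tensorForm p (Fin.append I J) := by
  ext1 x
  refine (wedge_smul_left _ _ _).trans ?_
  rw [wedge_idxForm]
  rfl

theorem wedge_tensorForm_right {k l : ℕ} (p : Fin 7) (I : Fin k → Fin 7) (J : Fin l → Fin 7) :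
    (wedgeL E7 ℝ k l (idxForm I)).comp (tensorForm p J) = tensorForm p (Fin.append I J) := by
  ext1 x
  refine (wedge_smul_right _ _ _).trans ?_
  rw [wedge_idxForm]
  rfl

/-- Moving the entry from place i to the front is a cycle of i + 1 letters, of sign (−1)^i. -/
theorem idxForm_insertNth {k : ℕ} (i : Fin (k + 1)) (p : Fin 7) (I : Fin k → Fin 7) :
    idxForm (i.insertNth p I : Fin (k + 1) → Fin 7) =
      (-1 : ℝ) ^ (i : ℕ) • idxForm (Fin.cons p I : Fin (k + 1) → Fin 7) := by
  rw [← Fin.cons_comp_cycleRange, idxForm_perm, Fin.sign_cycleRange]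
  congr 1
  push_cast
  rfl

theorem append_cons_eq_insertNth {k l : ℕ} (h : k + (l + 1) = k + l + 1) (p : Fin 7)
    (I : Fin k → Fin 7) (J : Fin l → Fin 7) :
    Fin.append I (Fin.cons p J : Fin (l + 1) → Fin 7) =
      ((⟨k, by omega⟩ : Fin (k + l + 1)).insertNth p (Fin.append I J) :
        Fin (k + l + 1) → Fin 7) ∘ Fin.cast h := by
  suffices H : Fin.append I (Fin.cons p J : Fin (l + 1) → Fin 7) ∘ Fin.cast h.symm =
      (⟨k, by omega⟩ : Fin (k + l + 1)).insertNth p (Fin.append I J) by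
    rw [← H]
    rfl
  rw [Fin.eq_insertNth_iff]
  constructor
  · have : Fin.cast h.symm ⟨k, by omega⟩ = Fin.natAdd k (0 : Fin (l + 1)) := rfl
    rw [Function.comp_apply, this, Fin.append_right, Fin.cons_zero]
  · funext j
    refine Fin.addCases (fun a => ?_) (fun a => ?_) j
    · have : Fin.cast h.symm ((⟨k, by omega⟩ : Fin (k + l + 1)).succAbove (Fin.castAdd l a)) =
          Fin.castAdd (l + 1) a := by
        rw [Fin.succAbove_of_castSucc_lt _ _ (by simp [Fin.lt_def])]
        rfl
      rw [Fin.removeNth_apply, Function.comp_apply, this, Fin.append_left, Fin.append_left]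
    · have : Fin.cast h.symm ((⟨k, by omega⟩ : Fin (k + l + 1)).succAbove (Fin.natAdd k a)) =
          Fin.natAdd k a.succ := by
        rw [Fin.succAbove_of_le_castSucc _ _ (by simp [Fin.le_def])]
        rfl
      rw [Fin.removeNth_apply, Function.comp_apply, this, Fin.append_right, Fin.append_right,
        Fin.cons_succ]

theorem alternatizeUncurryFin_zero {k : ℕ} :
    alternatizeUncurryFin (0 : E7 →L[ℝ] E7 [⋀^Fin k]→L[ℝ] ℝ) = 0 :=
  map_zero (ContinuousAlternatingMap.alternatizeUncurryFinCLM ℝ E7 ℝ)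

/-- Both sides are linear in B and in β, so B = dx^p ⊗ dx^I and β = dx^J suffice; there both are the
monomial (p, I, J). The cast identifies the degrees k + 1 + l and k + l + 1. -/
theorem alternatizeUncurryFin_wedge_left {k l : ℕ} (h : k + 1 + l = k + l + 1)
    (B : E7 →L[ℝ] E7 [⋀^Fin k]→L[ℝ] ℝ) (β : E7 [⋀^Fin l]→L[ℝ] ℝ) (v : Fin (k + l + 1) → E7) :
    alternatizeUncurryFin (((wedgeL E7 ℝ k l).flip β).comp B) v =
      wedge (alternatizeUncurryFin B) β (v ∘ Fin.cast h) := by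
  have hB : B ∈ Submodule.span ℝ (range fun p : Fin 7 × (Fin k → Fin 7) =>
    tensorForm p.1 p.2) := by rw [span_tensorForm]; trivial
  have hβ : β ∈ Submodule.span ℝ (range (idxForm : (Fin l → Fin 7) → _)) := by
    rw [span_idxForm]; trivial
  induction hB using Submodule.span_induction with
  | mem B hB =>
    obtain ⟨⟨p, I⟩, rfl⟩ := hB
    induction hβ using Submodule.span_induction with
    | mem β hβ =>
      obtain ⟨J, rfl⟩ := hβ
      simp only
      rw [wedge_tensorForm_left, alternatizeUncurryFin_tensorForm,
        alternatizeUncurryFin_tensorForm, wedge_idxForm, ← idxForm_cast h.symm]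
      congr 2
      rw [Fin.append_cons]
      rfl
    | zero => simp [alternatizeUncurryFin_zero, wedge_zero_right]
    | add β γ _ _ h1 h2 =>
      rw [map_add, ContinuousLinearMap.add_comp, ContinuousAlternatingMap.alternatizeUncurryFin_add,
        wedge_add_right, ContinuousAlternatingMap.add_apply, ContinuousAlternatingMap.add_apply,
        h1, h2]
    | smul c β _ h1 =>
      rw [map_smul, ContinuousLinearMap.smul_comp,
        ContinuousAlternatingMap.alternatizeUncurryFin_smul,
        wedge_smul_right, ContinuousAlternatingMap.smul_apply, ContinuousAlternatingMap.smul_apply,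
        h1]
  | zero => simp [alternatizeUncurryFin_zero, wedge_zero_left]
  | add B C _ _ h1 h2 =>
    rw [ContinuousLinearMap.comp_add, ContinuousAlternatingMap.alternatizeUncurryFin_add,
      ContinuousAlternatingMap.alternatizeUncurryFin_add,
      wedge_add_left, ContinuousAlternatingMap.add_apply, ContinuousAlternatingMap.add_apply,
      h1, h2]
  | smul c B _ h1 =>
    rw [ContinuousLinearMap.comp_smul, ContinuousAlternatingMap.alternatizeUncurryFin_smul,
      ContinuousAlternatingMap.alternatizeUncurryFin_smul,
      wedge_smul_left, ContinuousAlternatingMap.smul_apply, ContinuousAlternatingMap.smul_apply,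
      h1]

/-- On monomials, dx^p has to be moved past the k factors of α, which produces (−1)^k. -/
theorem alternatizeUncurryFin_wedge_right {k l : ℕ} (h : k + (l + 1) = k + l + 1)
    (α : E7 [⋀^Fin k]→L[ℝ] ℝ) (B : E7 →L[ℝ] E7 [⋀^Fin l]→L[ℝ] ℝ) (v : Fin (k + l + 1) → E7) :
    alternatizeUncurryFin ((wedgeL E7 ℝ k l α).comp B) v =
      (-1 : ℝ) ^ k * wedge α (alternatizeUncurryFin B) (v ∘ Fin.cast h) := by
  have hB : B ∈ Submodule.span ℝ (range fun p : Fin 7 × (Fin l → Fin 7) =>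
    tensorForm p.1 p.2) := by rw [span_tensorForm]; trivial
  have hα : α ∈ Submodule.span ℝ (range (idxForm : (Fin k → Fin 7) → _)) := by
    rw [span_idxForm]; trivial
  induction hB using Submodule.span_induction with
  | mem B hB =>
    obtain ⟨⟨p, J⟩, rfl⟩ := hB
    induction hα using Submodule.span_induction with
    | mem α hα =>
      obtain ⟨I, rfl⟩ := hα
      simp only
      rw [wedge_tensorForm_right, alternatizeUncurryFin_tensorForm,
        alternatizeUncurryFin_tensorForm, wedge_idxForm, append_cons_eq_insertNth h,
        idxForm_cast h, idxForm_insertNth, ContinuousAlternatingMap.smul_apply, smul_eq_mul,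
        ← mul_assoc, ← mul_pow]
      simp
    | zero => simp [alternatizeUncurryFin_zero, wedge_zero_left]
    | add β γ _ _ h1 h2 =>
      rw [map_add, ContinuousLinearMap.add_comp, ContinuousAlternatingMap.alternatizeUncurryFin_add,
        wedge_add_left, ContinuousAlternatingMap.add_apply, ContinuousAlternatingMap.add_apply,
        h1, h2, mul_add]
    | smul c β _ h1 =>
      rw [map_smul, ContinuousLinearMap.smul_comp,
        ContinuousAlternatingMap.alternatizeUncurryFin_smul,
        wedge_smul_left, ContinuousAlternatingMap.smul_apply, ContinuousAlternatingMap.smul_apply,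
        h1, smul_eq_mul, smul_eq_mul, mul_left_comm]
  | zero => simp [alternatizeUncurryFin_zero, wedge_zero_right]
  | add B C _ _ h1 h2 =>
    rw [ContinuousLinearMap.comp_add, ContinuousAlternatingMap.alternatizeUncurryFin_add,
      ContinuousAlternatingMap.alternatizeUncurryFin_add,
      wedge_add_right, ContinuousAlternatingMap.add_apply, ContinuousAlternatingMap.add_apply,
      h1, h2, mul_add]
  | smul c B _ h1 =>
    rw [ContinuousLinearMap.comp_smul, ContinuousAlternatingMap.alternatizeUncurryFin_smul,
      ContinuousAlternatingMap.alternatizeUncurryFin_smul,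
      wedge_smul_right, ContinuousAlternatingMap.smul_apply, ContinuousAlternatingMap.smul_apply,
      h1, smul_eq_mul, smul_eq_mul, mul_left_comm]

/-- The Leibniz rule `d(α ∧ β) = dα ∧ β + (-1)ᵏ α ∧ dβ`. -/
theorem extDeriv_wedge {k l : ℕ} {α : E7 → E7 [⋀^Fin k]→L[ℝ] ℝ} {β : E7 → E7 [⋀^Fin l]→L[ℝ] ℝ}
    {x : E7} (hα : DifferentiableAt ℝ α x) (hβ : DifferentiableAt ℝ β x)
    (hl : k + 1 + l = k + l + 1) (hr : k + (l + 1) = k + l + 1) (v : Fin (k + l + 1) → E7) :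
    extDeriv (fun y => wedge (α y) (β y)) x v =
      wedge (extDeriv α x) (β x) (v ∘ Fin.cast hl) +
        (-1 : ℝ) ^ k * wedge (α x) (extDeriv β x) (v ∘ Fin.cast hr) := by
  have h := (wedgeL E7 ℝ k l).fderiv_of_bilinear hα hβ
  rw [extDeriv]
  refine (congrArg (fun B => alternatizeUncurryFin B v) h).trans ?_
  rw [ContinuousAlternatingMap.alternatizeUncurryFin_add, ContinuousAlternatingMap.add_apply,
    add_comm]
  exact congrArg₂ _ (alternatizeUncurryFin_wedge_left hl _ _ v)
    (alternatizeUncurryFin_wedge_right hr _ _ v)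

end Leibniz

/-! ### The exterior derivative on a 7-manifold -/

section ManifoldForms

open ContinuousAlternatingMap (alternatizeUncurryFin alternatizeUncurryFin_apply
  alternatizeUncurryFinCLM)

variable {F G : Type*} [NormedAddCommGroup F] [NormedSpace ℝ F]
  [NormedAddCommGroup G] [NormedSpace ℝ G]

/-- Postcomposition of forms with a continuous linear map, as a continuous linear map. -/
def postcompL (k : ℕ) (L : F →L[ℝ] G) : (E7 [⋀^Fin k]→L[ℝ] F) →L[ℝ] E7 [⋀^Fin k]→L[ℝ] G :=
  LinearMap.mkContinuous
    { toFun := L.compContinuousAlternatingMap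
      map_add' := fun α β => by ext v; simp
      map_smul' := fun c α => by ext v; simp } ‖L‖ L.norm_compContinuousAlternatingMap_le

theorem postcompL_apply {k : ℕ} (L : F →L[ℝ] G) (α : E7 [⋀^Fin k]→L[ℝ] F) :
    postcompL k L α = L.compContinuousAlternatingMap α := rfl

theorem extDeriv_postcomp {k : ℕ} (L : F →L[ℝ] G) {α : E7 → E7 [⋀^Fin k]→L[ℝ] F} {x : E7}
    (hα : DifferentiableAt ℝ α x) :
    extDeriv (fun y => L.compContinuousAlternatingMap (α y)) x =
      L.compContinuousAlternatingMap (extDeriv α x) := by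
  have h : fderiv ℝ (fun y => L.compContinuousAlternatingMap (α y)) x =
      (postcompL k L).comp (fderiv ℝ α x) :=
    ((postcompL k L).hasFDerivAt.comp x hα.hasFDerivAt).fderiv
  rw [extDeriv, h, extDeriv]
  ext v
  simp [alternatizeUncurryFin_apply, postcompL_apply, map_sum]

variable {M : Type*} [TopologicalSpace M] [ChartedSpace E7 M]

namespace DForm

variable {k l : ℕ}

theorem inChart_add (α β : DForm M k F) (x₀ : M) :
    (α + β).inChart x₀ = α.inChart x₀ + β.inChart x₀ := rfl

theorem inChart_smul (c : ℝ) (α : DForm M k F) (x₀ : M) :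
    (c • α).inChart x₀ = c • α.inChart x₀ := rfl

theorem inChart_wedge (α : DForm M k ℝ) (β : DForm M l ℝ) (x₀ : M) :
    (α.wedge β).inChart x₀ = fun y => G2Flow.wedge (α.inChart x₀ y) (β.inChart x₀ y) :=
  funext fun _ => wedge_compContinuousLinearMap _ _ _

theorem inChart_re (α : DForm M k ℂ) (x₀ : M) :
    α.re.inChart x₀ = fun y => Complex.reCLM.compContinuousAlternatingMap (α.inChart x₀ y) := rfl

theorem inChart_im (α : DForm M k ℂ) (x₀ : M) :
    α.im.inChart x₀ = fun y => Complex.imCLM.compContinuousAlternatingMap (α.inChart x₀ y) := rfl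

theorem IsSmooth.add {α β : DForm M k F} (hα : α.IsSmooth) (hβ : β.IsSmooth) :
    (α + β).IsSmooth := fun x₀ => (hα x₀).add (hβ x₀)

theorem IsSmooth.const_smul {α : DForm M k F} (hα : α.IsSmooth) (c : ℝ) : (c • α).IsSmooth :=
  fun x₀ => (hα x₀).const_smul c

theorem IsSmooth.wedge {α : DForm M k ℝ} {β : DForm M l ℝ} (hα : α.IsSmooth) (hβ : β.IsSmooth) :
    (α.wedge β).IsSmooth := fun x₀ => by
  rw [inChart_wedge]
  exact (wedgeL E7 ℝ k l).isBoundedBilinearMap.contDiff.comp₂_contDiffOn (hα x₀) (hβ x₀)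

theorem IsSmooth.re {α : DForm M k ℂ} (hα : α.IsSmooth) : α.re.IsSmooth := fun x₀ =>
  (postcompL k Complex.reCLM).contDiff.comp_contDiffOn (hα x₀)

theorem IsSmooth.im {α : DForm M k ℂ} (hα : α.IsSmooth) : α.im.IsSmooth := fun x₀ =>
  (postcompL k Complex.imCLM).contDiff.comp_contDiffOn (hα x₀)

theorem IsSmooth.contDiffAt {α : DForm M k F} (hα : α.IsSmooth) {x₀ : M} {y : E7}
    (hy : y ∈ (extChartAt (𝓡 7) x₀).target) : ContDiffAt ℝ ∞ (α.inChart x₀) y :=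
  (hα x₀).contDiffAt ((isOpen_extChartAt_target x₀).mem_nhds hy)

theorem IsSmooth.differentiableAt {α : DForm M k F} (hα : α.IsSmooth) {x₀ : M} {y : E7}
    (hy : y ∈ (extChartAt (𝓡 7) x₀).target) : DifferentiableAt ℝ (α.inChart x₀) y :=
  (hα.contDiffAt hy).differentiableAt (by simp)

theorem IsSmooth.differentiableAt_self {α : DForm M k F} (hα : α.IsSmooth) (x : M) :
    DifferentiableAt ℝ (α.inChart x) (extChartAt (𝓡 7) x x) :=
  hα.differentiableAt (mem_extChartAt_target x)

theorem d_add {α β : DForm M k F} (hα : α.IsSmooth) (hβ : β.IsSmooth) :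
    (α + β).d = α.d + β.d := by
  funext x
  rw [d, inChart_add, extDeriv_add (hα.differentiableAt_self x) (hβ.differentiableAt_self x)]
  rfl

theorem d_smul (c : ℝ) (α : DForm M k F) : (c • α).d = c • α.d := by
  funext x
  rw [d, inChart_smul, extDeriv_smul]
  rfl

theorem d_zero : (0 : DForm M k F).d = 0 := by
  have := d_smul 0 (0 : DForm M k F)
  rwa [zero_smul, zero_smul] at this

theorem d_re {α : DForm M k ℂ} (hα : α.IsSmooth) : α.re.d = α.d.re := by
  funext x
  rw [d, inChart_re, extDeriv_postcomp _ (hα.differentiableAt_self x)]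
  rfl

theorem d_im {α : DForm M k ℂ} (hα : α.IsSmooth) : α.im.d = α.d.im := by
  funext x
  rw [d, inChart_im, extDeriv_postcomp _ (hα.differentiableAt_self x)]
  rfl

theorem smul_apply_six (c : ℝ) (α : DForm M 6 ℝ) (x : M) : (c • α) x = c • α x := rfl

theorem wedge_zero_apply (α : DForm M k ℝ) (x : M) :
    α.wedge (0 : DForm M l ℝ) x = 0 := G2Flow.wedge_zero_right _

theorem zero_wedge_apply (β : DForm M l ℝ) (x : M) :
    (0 : DForm M k ℝ).wedge β x = 0 := G2Flow.wedge_zero_left _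

theorem star_smul (h : k + l = 7) (g : BilinField M) (μ : DForm M 7 ℝ) (c : ℝ)
    (α : DForm M k ℝ) : DForm.star k l h g μ (c • α) = c • DForm.star k l h g μ α :=
  funext fun _ => hodgeStar_smul h _ _ c _

theorem star_zero (h : k + l = 7) (g : BilinField M) (μ : DForm M 7 ℝ) :
    DForm.star k l h g μ 0 = 0 := by
  have := star_smul h g μ 0 0
  rwa [zero_smul, zero_smul] at this

theorem codiff_eq {p l : ℕ} {h : p + 1 + l = 7} {g : BilinField M} {μ : DForm M 7 ℝ}
    {α : DForm M (p + 1) ℝ} {β : DForm M p ℝ}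
    (hβ : DForm.star (l + 1) p (by omega) g μ (DForm.star (p + 1) l h g μ α).d = β) :
    DForm.codiff p l h g μ α = (-1 : ℝ) ^ (p + 1) • β := by
  rw [DForm.codiff, hβ]

theorem mem_coordChange_source {x₀ p : M} {y : E7} (hy : y ∈ (extChartAt (𝓡 7) x₀).target)
    (hp : (extChartAt (𝓡 7) x₀).symm y ∈ (extChartAt (𝓡 7) p).source) :
    y ∈ ((extChartAt (𝓡 7) x₀).symm ≫ extChartAt (𝓡 7) p).source := by
  rw [PartialEquiv.trans_source]
  exact ⟨hy, hp⟩

theorem minSmoothness_two_le : minSmoothness ℝ 2 ≤ (∞ : WithTop ℕ∞) := by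
  rw [minSmoothness_of_isRCLikeNormedField]
  exact WithTop.coe_le_coe.2 (le_top (a := (2 : ℕ∞)))

variable [IsManifold (𝓡 7) ∞ M]

theorem mdifferentiableAt_symm {x₀ : M} {y : E7} (hy : y ∈ (extChartAt (𝓡 7) x₀).target) :
    MDifferentiableAt 𝓘(ℝ, E7) (𝓡 7) (extChartAt (𝓡 7) x₀).symm y := by
  have : IsManifold (𝓡 7) 1 M := IsManifold.of_le (n := ∞) (by simp)
  have := mdifferentiableWithinAt_extChartAt_symm (I := 𝓡 7) hy
  rwa [ModelWithCorners.range_eq_univ, mdifferentiableWithinAt_univ] at this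

/-- The pullback of a form by the derivatives of the charts is its value at the base point. -/
theorem inChart_self (α : DForm M k F) (x : M) :
    (α.inChart x (extChartAt (𝓡 7) x x)).compContinuousLinearMap
      (mfderiv (𝓡 7) 𝓘(ℝ, E7) (extChartAt (𝓡 7) x) x) = α x := by
  have : IsManifold (𝓡 7) 1 M := IsManifold.of_le (n := ∞) (by simp)
  -- Going to the chart and back returns to x only up to a propositional equality, so the tangent
  -- spaces differ as types. Both are copies of `E7`, and vectors are compared there.
  have key : ∀ (p : M) (_ : p = x) (L : TangentSpace (𝓡 7) x →L[ℝ] TangentSpace (𝓡 7) p)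
      (_ : ∀ v, (L v : E7) = (v : E7)), (α p).compContinuousLinearMap L = α x := by
    rintro p rfl L hL
    ext v
    exact congrArg (α p) (funext fun i => hL (v i))
  have hid := mfderivWithin_extChartAt_symm_comp_mfderiv_extChartAt' (I := 𝓡 7)
    (mem_extChartAt_source (I := 𝓡 7) x)
  rw [ModelWithCorners.range_eq_univ, mfderivWithin_univ] at hid
  refine key _ (extChartAt_to_inv x) ((mfderiv 𝓘(ℝ, E7) (𝓡 7) (extChartAt (𝓡 7) x).symm
    (extChartAt (𝓡 7) x x)).comp (mfderiv (𝓡 7) 𝓘(ℝ, E7) (extChartAt (𝓡 7) x) x)) fun v => ?_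
  exact DFunLike.congr_fun hid v

theorem mfderiv_comp_symm {x₀ p : M} {y : E7} (hy : y ∈ (extChartAt (𝓡 7) x₀).target)
    (hp : (extChartAt (𝓡 7) x₀).symm y ∈ (extChartAt (𝓡 7) p).source) :
    fderiv ℝ (extChartAt (𝓡 7) p ∘ (extChartAt (𝓡 7) x₀).symm) y =
      (mfderiv (𝓡 7) 𝓘(ℝ, E7) (extChartAt (𝓡 7) p) ((extChartAt (𝓡 7) x₀).symm y)).comp
        (mfderiv 𝓘(ℝ, E7) (𝓡 7) (extChartAt (𝓡 7) x₀).symm y) := by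
  have : IsManifold (𝓡 7) 1 M := IsManifold.of_le (n := ∞) (by simp)
  rw [← mfderiv_eq_fderiv]
  exact mfderiv_comp y (mdifferentiableAt_extChartAt (by rwa [extChartAt_source] at hp))
    (mdifferentiableAt_symm hy)

theorem contDiffAt_coordChange {x₀ p : M} {y : E7} (hy : y ∈ (extChartAt (𝓡 7) x₀).target)
    (hp : (extChartAt (𝓡 7) x₀).symm y ∈ (extChartAt (𝓡 7) p).source) :
    ContDiffAt ℝ ∞ (extChartAt (𝓡 7) p ∘ (extChartAt (𝓡 7) x₀).symm) y := by
  have := contDiffWithinAt_ext_coord_change (I := 𝓡 7) (n := ∞) p x₀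
    (mem_coordChange_source hy hp)
  rwa [ModelWithCorners.range_eq_univ, contDiffWithinAt_univ] at this

/-- The chart expressions of a form are related by the coordinate changes. -/
theorem inChart_coordChange (α : DForm M k F) {x₀ p : M} {y : E7}
    (hy : y ∈ (extChartAt (𝓡 7) x₀).target)
    (hp : (extChartAt (𝓡 7) x₀).symm y ∈ (extChartAt (𝓡 7) p).source) :
    α.inChart x₀ y =
      (α.inChart p ((extChartAt (𝓡 7) p ∘ (extChartAt (𝓡 7) x₀).symm) y)).compContinuousLinearMap
        (fderiv ℝ (extChartAt (𝓡 7) p ∘ (extChartAt (𝓡 7) x₀).symm) y) := by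
  have : IsManifold (𝓡 7) 1 M := IsManifold.of_le (n := ∞) (by simp)
  have key : ∀ (q r : M) (_ : q = r) (K : E7 →L[ℝ] TangentSpace (𝓡 7) q)
      (L : E7 →L[ℝ] TangentSpace (𝓡 7) r)
      (_ : ∀ v, (L v : E7) = (K v : E7)),
      (α r).compContinuousLinearMap L = (α q).compContinuousLinearMap K := by
    rintro q r rfl K L hL
    ext v
    exact congrArg (α q) (funext fun i => hL (v i))
  set τ := extChartAt (𝓡 7) p ∘ (extChartAt (𝓡 7) x₀).symm with hτ
  have hτy : τ y ∈ (extChartAt (𝓡 7) p).target := (extChartAt (𝓡 7) p).map_source hp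
  have hev : (extChartAt (𝓡 7) p).symm ∘ τ =ᶠ[𝓝 y] (extChartAt (𝓡 7) x₀).symm := by
    have h1 : ∀ᶠ z in 𝓝 y, (extChartAt (𝓡 7) x₀).symm z ∈ (extChartAt (𝓡 7) p).source :=
      (continuousAt_extChartAt_symm'' hy).eventually
        ((isOpen_extChartAt_source p).mem_nhds hp)
    filter_upwards [h1] with z hz
    exact (extChartAt (𝓡 7) p).left_inv hz
  have hd := hev.mfderiv_eq (I := 𝓘(ℝ, E7)) (I' := 𝓡 7)
  rw [mfderiv_comp y (mdifferentiableAt_symm hτy)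
    ((contDiffAt_coordChange hy hp).differentiableAt (by simp)).mdifferentiableAt,
    mfderiv_eq_fderiv] at hd
  refine key _ _ hev.self_of_nhds ((mfderiv 𝓘(ℝ, E7) (𝓡 7) (extChartAt (𝓡 7) p).symm
    (τ y)).comp (fderiv ℝ τ y)) _ fun v => ?_
  exact (DFunLike.congr_fun hd v).symm

/-- `DForm.d` uses a different chart at every point. Naturality of `extDeriv` under coordinate
changes shows that one chart computes it on its whole target; smoothness of dα and d² = 0 depend on
this. -/
theorem inChart_d {α : DForm M k F} (hα : α.IsSmooth) {x₀ : M} {y : E7}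
    (hy : y ∈ (extChartAt (𝓡 7) x₀).target) :
    α.d.inChart x₀ y = extDeriv (α.inChart x₀) y := by
  set p := (extChartAt (𝓡 7) x₀).symm y with hp
  have hps : p ∈ (extChartAt (𝓡 7) p).source := mem_extChartAt_source p
  set τ := extChartAt (𝓡 7) p ∘ (extChartAt (𝓡 7) x₀).symm with hτ
  have hev : α.inChart x₀ =ᶠ[𝓝 y]
      fun z => (α.inChart p (τ z)).compContinuousLinearMap (fderiv ℝ τ z) := by
    have h1 : ∀ᶠ z in 𝓝 y, (extChartAt (𝓡 7) x₀).symm z ∈ (extChartAt (𝓡 7) p).source :=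
      (continuousAt_extChartAt_symm'' hy).eventually
        ((isOpen_extChartAt_source p).mem_nhds hps)
    filter_upwards [h1, (isOpen_extChartAt_target x₀).mem_nhds hy] with z hz hz'
    exact inChart_coordChange α hz' hz
  have hpull := extDeriv_pullback (f := τ) (x := y) (G := F) (r := ∞)
    (hα.differentiableAt ((extChartAt (𝓡 7) p).map_source hps))
    (contDiffAt_coordChange hy hps) minSmoothness_two_le
  rw [mfderiv_comp_symm hy hps] at hpull
  rw [hev.extDeriv_eq]
  exact hpull.symm

theorem IsSmooth.d {α : DForm M k F} (hα : α.IsSmooth) : α.d.IsSmooth := fun x₀ => by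
  refine ContDiffOn.congr ?_ fun y hy => inChart_d hα hy
  exact (alternatizeUncurryFinCLM ℝ E7 F).contDiff.comp_contDiffOn
    ((hα x₀).fderiv_of_isOpen (isOpen_extChartAt_target x₀) (m := ∞) (by simp))

theorem d_d {α : DForm M k F} (hα : α.IsSmooth) : α.d.d = 0 := by
  funext x
  have hev : α.d.inChart x =ᶠ[𝓝 (extChartAt (𝓡 7) x x)] extDeriv (α.inChart x) := by
    filter_upwards [extChartAt_target_mem_nhds (I := 𝓡 7) x] with y hy
    exact inChart_d hα hy
  rw [d, hev.extDeriv_eq,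
    extDeriv_extDeriv_apply (hα.contDiffAt (mem_extChartAt_target x))
      minSmoothness_two_le]
  rfl

/-- The Leibniz rule in the chart at x, pulled back to the tangent space; `inChart_self` identifies
the undifferentiated factors. -/
theorem d_wedge_apply {α : DForm M k ℝ} {β : DForm M l ℝ} (hα : α.IsSmooth) (hβ : β.IsSmooth)
    (hl : k + 1 + l = k + l + 1) (hr : k + (l + 1) = k + l + 1) (x : M)
    (v : Fin (k + l + 1) → TangentSpace (𝓡 7) x) :
    (α.wedge β).d x v = α.d.wedge β x (v ∘ Fin.cast hl) +
      (-1 : ℝ) ^ k * α.wedge β.d x (v ∘ Fin.cast hr) := by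
  have h := extDeriv_wedge (hα.differentiableAt_self x) (hβ.differentiableAt_self x) hl hr
    ((mfderiv (𝓡 7) 𝓘(ℝ, E7) (extChartAt (𝓡 7) x) x) ∘ v)
  rw [← inChart_wedge] at h
  refine h.trans ?_
  have h1 : α.d.wedge β x = (G2Flow.wedge (extDeriv (α.inChart x) (extChartAt (𝓡 7) x x))
      (β.inChart x (extChartAt (𝓡 7) x x))).compContinuousLinearMap
        (mfderiv (𝓡 7) 𝓘(ℝ, E7) (extChartAt (𝓡 7) x) x) := by
    refine Eq.trans ?_ (wedge_compContinuousLinearMap (V := TangentSpace (𝓡 7) x) (W := E7)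
      _ _ _).symm
    exact congrArg (G2Flow.wedge _) (inChart_self β x).symm
  have h2 : α.wedge β.d x = (G2Flow.wedge (α.inChart x (extChartAt (𝓡 7) x x))
      (extDeriv (β.inChart x) (extChartAt (𝓡 7) x x))).compContinuousLinearMap
        (mfderiv (𝓡 7) 𝓘(ℝ, E7) (extChartAt (𝓡 7) x) x) := by
    refine Eq.trans ?_ (wedge_compContinuousLinearMap (V := TangentSpace (𝓡 7) x) (W := E7)
      _ _ _).symm
    exact congrArg (fun γ => G2Flow.wedge γ (β.d x)) (inChart_self α x).symm
  rw [h1, h2]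
  rfl

end DForm

end ManifoldForms

/-! ### The `G₂`-structures of a contact Calabi–Yau 7-manifold -/

namespace ContactCalabiYau

section G2Family

variable {M : Type*} [TopologicalSpace M] [ChartedSpace E7 M] [IsManifold (𝓡 7) ∞ M]

/-- The three degrees are the same number written differently; this evaluates an equality of 6-forms
across them. -/
theorem coe_congr_six {V : Type*} [AddCommGroup V] [Module ℝ V] [TopologicalSpace V]
    {α : V [⋀^Fin (1 + 1 + (1 + 1) + (1 + 1))]→L[ℝ] ℝ} {β : V [⋀^Fin (2 + 2 + 2)]→L[ℝ] ℝ}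
    (h : α = β) (v : Fin (3 + 3) → V) : α v = β v := by
  subst h
  rfl

theorem kahler_cube_apply (C : ContactCalabiYau M) (x : M) :
    ((C.η.d.wedge C.η.d).wedge C.η.d) x =
      G2Flow.wedge (G2Flow.wedge (C.kahler x) (C.kahler x)) (C.kahler x) := rfl

theorem isPointwiseCalabiYau (C : ContactCalabiYau M) (x : M) :
    IsPointwiseCalabiYau (C.η x) (C.g.inner x) (C.ξ x) (C.Φ x)
      (C.kahler x) (C.Υ x) where
  symm := C.g.symm x
  pos := C.g.pos x
  η_ξ := C.η_ξ x
  Φ_sq := C.Φ_sq x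
  g_Φ := C.g_Φ x
  κ_eq := C.dη_eq x
  Υ_ξ := C.Υ_ξ x
  Υ_type := C.Υ_type x
  Υ_norm v := by
    have h1 := C.Υ_norm x v
    have h2 : (C.Υ.wedge C.Υ.conj) x = G2Flow.wedge (C.Υ x)
      ((Complex.conjCLE : ℂ →L[ℝ] ℂ).compContinuousAlternatingMap (C.Υ x)) := rfl
    rw [← h2, h1, coe_congr_six (C.kahler_cube_apply x)]

/-- The 3-form `r η ∧ ω + Re Υ`. -/
def g2Form (C : ContactCalabiYau M) (r : ℝ) : DForm M 3 ℝ := r • C.η.wedge C.kahler + C.Υ.re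

theorem volD_eq (C : ContactCalabiYau M) :
    C.volD = HSMul.hSMul (α := ℝ) (β := DForm M 6 ℝ) (γ := DForm M 6 ℝ) (6 : ℝ)⁻¹
      ((C.kahler.wedge C.kahler).wedge C.kahler) := by
  have h : ((Nat.factorial 3 : ℝ)⁻¹) = (6 : ℝ)⁻¹ := by norm_num [Nat.factorial]
  rw [volD, h]

theorem volD_apply (C : ContactCalabiYau M) (x : M) : C.volD x = transverseVol (C.kahler x) := by
  rw [volD_eq, DForm.smul_apply_six, transverseVol]
  exact congrArg (fun α => (6 : ℝ)⁻¹ • α) (C.kahler_cube_apply x)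

theorem g2Form_pointwise (C : ContactCalabiYau M) {r : ℝ} (hr : r ≠ 0) (x : M) :
    (∃ u : TangentSpace (𝓡 7) x ≃L[ℝ] E7, C.g2Form r x =
      stdG2Form.compContinuousLinearMap (u : TangentSpace (𝓡 7) x →L[ℝ] E7)) ∧
    (∀ X Y, g2Metric (C.g2Form r) x X Y = r ^ 2 * (C.η x ![X] * C.η x ![Y]) + C.gD x X Y) ∧
    g2Vol (C.g2Form r) x = r • G2Flow.wedge (C.η x) (C.volD x) ∧
    g2Dual (C.g2Form r) x = (1 / 2 : ℝ) • G2Flow.wedge (C.kahler x) (C.kahler x) -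
      r • G2Flow.wedge (C.η x) (C.Υ.im x) ∧
    hodgeStar 4 3 rfl (g2Metric (C.g2Form r) x) (g2Vol (C.g2Form r) x)
      (G2Flow.wedge (C.kahler x) (C.kahler x)) =
      (2 * r) • G2Flow.wedge (C.η x) (C.kahler x) ∧
    G2Flow.wedge (C.kahler x) (C.Υ.im x) = 0 := by
  have : T2Space (TangentSpace (𝓡 7) x) := inferInstanceAs (T2Space E7)
  have : FiniteDimensional ℝ (TangentSpace (𝓡 7) x) :=
    inferInstanceAs (FiniteDimensional ℝ E7)
  have hV : Module.finrank ℝ (TangentSpace (𝓡 7) x) = 7 :=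
    finrank_euclideanSpace_fin (𝕜 := ℝ) (n := 7)
  obtain ⟨u, h1, h2, h3, h4, h5, h6, h7⟩ :=
    (C.isPointwiseCalabiYau x).g2Form_properties hV hr
  have hg : g2Metric (C.g2Form r) x = _ := congrArg Prod.fst h2
  have hμ : g2Vol (C.g2Form r) x = _ := congrArg Prod.snd h2
  refine ⟨⟨u, h1⟩, fun X Y => ?_, ?_, ?_, ?_, h7⟩
  · rw [hg]
    exact h3 X Y
  · rw [hμ, volD_apply]
    exact h4
  · rw [g2Dual, DForm.star, hg, hμ]
    exact h5
  · rw [hg, hμ]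
    exact h6

theorem smooth_kahler (C : ContactCalabiYau M) : C.kahler.IsSmooth := C.smooth_η.d

theorem smooth_g2Form (C : ContactCalabiYau M) (r : ℝ) : (C.g2Form r).IsSmooth :=
  ((C.smooth_η.wedge C.smooth_kahler).const_smul r).add C.smooth_Υ.re

theorem isG2Structure_g2Form (C : ContactCalabiYau M) {r : ℝ} (hr : r ≠ 0) :
    IsG2Structure (C.g2Form r) :=
  ⟨C.smooth_g2Form r, fun x => (C.g2Form_pointwise hr x).1⟩

theorem g2Metric_g2Form (C : ContactCalabiYau M) {r : ℝ} (hr : r ≠ 0) (x : M)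
    (X Y : TangentSpace (𝓡 7) x) :
    g2Metric (C.g2Form r) x X Y = r ^ 2 * (C.η x ![X] * C.η x ![Y]) + C.gD x X Y :=
  (C.g2Form_pointwise hr x).2.1 X Y

/-- The transverse metric vanishes on ξ. This gives both the blow-up of the metrics and the
nonvanishing of η∧ω. -/
theorem g2Metric_g2Form_reeb (C : ContactCalabiYau M) {r : ℝ} (hr : r ≠ 0) (x : M) :
    g2Metric (C.g2Form r) x (C.ξ x) (C.ξ x) = r ^ 2 := by
  rw [C.g2Metric_g2Form hr, gD, C.η_ξ, one_smul, sub_self, map_zero]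
  simp

theorem g2Vol_g2Form (C : ContactCalabiYau M) {r : ℝ} (hr : r ≠ 0) :
    g2Vol (C.g2Form r) = r • C.η.wedge C.volD :=
  funext fun x => (C.g2Form_pointwise hr x).2.2.1

theorem g2Dual_g2Form (C : ContactCalabiYau M) {r : ℝ} (hr : r ≠ 0) :
    g2Dual (C.g2Form r) =
      (1 / 2 : ℝ) • C.kahler.wedge C.kahler - r • C.η.wedge C.Υ.im :=
  funext fun x => (C.g2Form_pointwise hr x).2.2.2.1

theorem star_kahler_wedge_kahler (C : ContactCalabiYau M) {r : ℝ} (hr : r ≠ 0) :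
    DForm.star 4 3 rfl (g2Metric (C.g2Form r)) (g2Vol (C.g2Form r)) (C.kahler.wedge C.kahler) =
      (2 * r) • C.η.wedge C.kahler :=
  funext fun x => (C.g2Form_pointwise hr x).2.2.2.2.1

/-- The identity does not involve r; r = 1 is an arbitrary choice. -/
theorem kahler_wedge_im (C : ContactCalabiYau M) : C.kahler.wedge C.Υ.im = 0 :=
  funext fun x => (C.g2Form_pointwise one_ne_zero x).2.2.2.2.2

theorem d_kahler (C : ContactCalabiYau M) : C.kahler.d = 0 := DForm.d_d C.smooth_η

theorem d_re (C : ContactCalabiYau M) : C.Υ.re.d = 0 := by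
  rw [DForm.d_re C.smooth_Υ, C.closed_Υ]
  funext x
  ext v
  simp [DForm.re]

theorem d_im (C : ContactCalabiYau M) : C.Υ.im.d = 0 := by
  rw [DForm.d_im C.smooth_Υ, C.closed_Υ]
  funext x
  ext v
  simp [DForm.im]

theorem d_η_wedge_kahler (C : ContactCalabiYau M) :
    (C.η.wedge C.kahler).d = C.kahler.wedge C.kahler := by
  funext x
  ext v
  refine (DForm.d_wedge_apply C.smooth_η C.smooth_kahler rfl rfl x v).trans ?_
  rw [d_kahler, DForm.wedge_zero_apply]
  simp
  rfl

theorem d_kahler_wedge_kahler (C : ContactCalabiYau M) : (C.kahler.wedge C.kahler).d = 0 := by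
  funext x
  ext v
  refine (DForm.d_wedge_apply C.smooth_kahler C.smooth_kahler rfl rfl x v).trans ?_
  rw [d_kahler, DForm.wedge_zero_apply, DForm.zero_wedge_apply]
  simp

/-- dη∧Im Υ = ω∧Im Υ vanishes by type, and η∧d Im Υ because Υ is closed. -/
theorem d_η_wedge_im (C : ContactCalabiYau M) : (C.η.wedge C.Υ.im).d = 0 := by
  funext x
  ext v
  refine (DForm.d_wedge_apply C.smooth_η C.smooth_Υ.im rfl rfl x v).trans ?_
  rw [d_im, DForm.wedge_zero_apply, show C.η.d.wedge C.Υ.im = 0 from C.kahler_wedge_im]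
  simp

theorem d_g2Form (C : ContactCalabiYau M) (r : ℝ) :
    (C.g2Form r).d = r • C.kahler.wedge C.kahler := by
  rw [← d_η_wedge_kahler]
  refine (DForm.d_add ((C.smooth_η.wedge C.smooth_kahler).const_smul r) C.smooth_Υ.re).trans ?_
  rw [d_re, DForm.d_smul, add_zero]

theorem isCoclosed_g2Form (C : ContactCalabiYau M) {r : ℝ} (hr : r ≠ 0) :
    IsCoclosed (C.g2Form r) := by
  have h : g2Dual (C.g2Form r) =
      ((1 / 2 : ℝ) • C.kahler.wedge C.kahler + (-r) • C.η.wedge C.Υ.im : DForm M 4 ℝ) := by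
    rw [C.g2Dual_g2Form hr, neg_smul, ← sub_eq_add_neg]
  rw [IsCoclosed, h]
  refine (DForm.d_add ((C.smooth_kahler.wedge C.smooth_kahler).const_smul _)
    ((C.smooth_η.wedge C.smooth_Υ.im).const_smul _)).trans ?_
  rw [DForm.d_smul, DForm.d_smul, d_kahler_wedge_kahler, d_η_wedge_im, smul_zero, smul_zero,
    add_zero]

/-- `Δ_φ φ = 4 r³ η ∧ ω` for `φ = r η ∧ ω + Re Υ`. -/
theorem laplacian3_g2Form (C : ContactCalabiYau M) {r : ℝ} (hr : r ≠ 0) :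
    DForm.laplacian3 (g2Metric (C.g2Form r)) (g2Vol (C.g2Form r)) (C.g2Form r) =
      (4 * r ^ 3) • C.η.wedge C.kahler := by
  -- φ is coclosed, so the term dd*φ of the Laplacian vanishes.
  have h1 : DForm.codiff 2 4 rfl (g2Metric (C.g2Form r)) (g2Vol (C.g2Form r)) (C.g2Form r) = 0 := by
    have hc : (DForm.star 3 4 rfl (g2Metric (C.g2Form r)) (g2Vol (C.g2Form r)) (C.g2Form r)).d = 0 :=
      C.isCoclosed_g2Form hr
    rw [DForm.codiff, hc, DForm.star_zero, smul_zero]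
  have h2 : DForm.star 4 3 rfl (g2Metric (C.g2Form r)) (g2Vol (C.g2Form r)) (C.g2Form r).d =
      (2 * r ^ 2) • C.η.wedge C.kahler := by
    rw [d_g2Form]
    refine (DForm.star_smul _ _ _ _ _).trans ?_
    rw [C.star_kahler_wedge_kahler hr, smul_smul]
    congr 1
    ring
  have h3 : (DForm.star 4 3 rfl (g2Metric (C.g2Form r)) (g2Vol (C.g2Form r)) (C.g2Form r).d).d =
      (2 * r ^ 2) • C.kahler.wedge C.kahler := by
    rw [h2, ← d_η_wedge_kahler]
    exact DForm.d_smul _ _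
  -- Each star of ω² contributes a factor 2r: r·2r = 2r² from the first, then 2r²·2r = 4r³.
  have h4 : DForm.star 4 3 rfl (g2Metric (C.g2Form r)) (g2Vol (C.g2Form r))
      (DForm.star 4 3 rfl (g2Metric (C.g2Form r)) (g2Vol (C.g2Form r)) (C.g2Form r).d).d =
      (4 * r ^ 3) • C.η.wedge C.kahler := by
    rw [h3]
    refine (DForm.star_smul _ _ _ _ _).trans ?_
    rw [C.star_kahler_wedge_kahler hr, smul_smul]
    congr 1
    ring
  have h5 : DForm.codiff 3 3 rfl (g2Metric (C.g2Form r)) (g2Vol (C.g2Form r)) (C.g2Form r).d =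
      (4 * r ^ 3) • C.η.wedge C.kahler := by
    rw [DForm.codiff_eq h4]
    -- The sign of the codifferential on 4-forms is (−1)⁴ = 1.
    norm_num
  rw [DForm.laplacian3, h1, h5, DForm.d_zero, zero_add]

/-- `η ∧ ω` vanishes nowhere. -/
theorem η_wedge_kahler_ne_zero (C : ContactCalabiYau M) (x : M) :
    (C.η.wedge C.kahler) x ≠ 0 := by
  intro h
  -- If η∧ω vanished at x, the G₂-form there would not depend on r, although its metric gives ξ the
  -- squared length r².
  have h12 : C.g2Form 1 x = C.g2Form 2 x := by
    change (1 : ℝ) • (C.η.wedge C.kahler) x + _ = (2 : ℝ) • (C.η.wedge C.kahler) x + _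
    rw [h, smul_zero, smul_zero]
  have h1 := C.g2Metric_g2Form_reeb one_ne_zero x
  have h2 := C.g2Metric_g2Form_reeb two_ne_zero x
  rw [g2Metric, h12] at h1
  rw [g2Metric, h1] at h2
  norm_num at h2

end G2Family

end ContactCalabiYau

/-! ### The time dependence of the flow -/

namespace ContactCalabiYau

theorem q_zero (ε : ℝ) : q ε 0 = 1 := by simp [q]

theorem one_sub_pos_of_lt {ε t : ℝ} (hε : 0 < ε) (ht : t < 1 / (8 * ε ^ 2)) :
    0 < 1 - 8 * ε ^ 2 * t := by
  rw [lt_div_iff₀ (by positivity)] at ht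
  linarith

theorem q_pos {ε t : ℝ} (hε : 0 < ε) (ht : t < 1 / (8 * ε ^ 2)) : 0 < q ε t :=
  Real.rpow_pos_of_pos (one_sub_pos_of_lt hε ht) _

/-- Multiplied by ε, this is the ODE r' = 4r³ for r = εq. The exponent of q³ is −3/2, that of the
derivative of the power −1/2. -/
theorem hasDerivAt_q {ε t : ℝ} (hε : 0 < ε) (ht : t < 1 / (8 * ε ^ 2)) :
    HasDerivAt (q ε) (4 * ε ^ 2 * q ε t ^ 3) t := by
  have h0 := one_sub_pos_of_lt hε ht
  have h1 : HasDerivAt (fun s => 1 - 8 * ε ^ 2 * s) (-(8 * ε ^ 2)) t := by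
    simpa using ((hasDerivAt_id t).const_mul (8 * ε ^ 2)).const_sub 1
  have h2 := h1.rpow_const (p := -(1 / 2)) (Or.inl h0.ne')
  refine h2.congr_deriv ?_
  have h3 : q ε t ^ 3 = (1 - 8 * ε ^ 2 * t) ^ (-(1 / 2) - 1 : ℝ) := by
    rw [q, ← Real.rpow_natCast, ← Real.rpow_mul h0.le]
    norm_num
  rw [h3]
  ring

theorem tendsto_q {ε : ℝ} (hε : 0 < ε) :
    Tendsto (q ε) (𝓝[<] (1 / (8 * ε ^ 2))) atTop := by
  refine (tendsto_rpow_neg_nhdsGT_zero (by norm_num : (-(1 / 2) : ℝ) < 0)).comp ?_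
  refine tendsto_nhdsWithin_iff.2 ⟨?_, ?_⟩
  · have hc : Continuous fun s : ℝ => 1 - 8 * ε ^ 2 * s := by fun_prop
    have := (hc.tendsto (1 / (8 * ε ^ 2))).mono_left
      (nhdsWithin_le_nhds (s := Iio (1 / (8 * ε ^ 2))))
    rwa [mul_one_div_cancel (by positivity), sub_self] at this
  · filter_upwards [self_mem_nhdsWithin] with s hs
    exact one_sub_pos_of_lt hε hs

end ContactCalabiYau

end G2Flow

end

/-! ### The flow and its singularity. -/

theorem theorem1p2 {M : Type*} [TopologicalSpace M] [T2Space M] [SecondCountableTopology M]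
    [Nonempty M] [ChartedSpace G2Flow.E7 M] [IsManifold (𝓡 7) ∞ M]
    (C : G2Flow.ContactCalabiYau M) (ε : ℝ) (hε : 0 < ε)
    (T : ℝ) (hT : T = 1 / (8 * ε ^ 2))
    (φ : ℝ → G2Flow.DForm M 3 ℝ)
    (hφ : ∀ t, φ t = (ε * G2Flow.ContactCalabiYau.q ε t) • C.η.wedge C.kahler + C.Υ.re) :
    -- initial condition
    φ 0 = ε • C.η.wedge C.kahler + C.Υ.re ∧
    -- the family solves the Laplacian flow on the ancient interval
    G2Flow.IsLaplacianFlow φ (Iio T) ∧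
    -- coclosedness, and the associated metric, volume form and dual 4-form
    (∀ t < T,
      G2Flow.IsCoclosed (φ t) ∧
      G2Flow.g2Dual (φ t) = (1 / 2 : ℝ) • C.kahler.wedge C.kahler
        - (ε * G2Flow.ContactCalabiYau.q ε t) • C.η.wedge C.Υ.im ∧
      (∀ x X Y, G2Flow.g2Metric (φ t) x X Y =
        ε ^ 2 * G2Flow.ContactCalabiYau.q ε t ^ 2 * (C.η x ![X] * C.η x ![Y]) + C.gD x X Y) ∧
      G2Flow.g2Vol (φ t) = (ε * G2Flow.ContactCalabiYau.q ε t) • C.η.wedge C.volD) ∧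
    -- finite-time singularity at `T`: the metrics blow up at every point, and no
    -- solution of the flow continues the family past `T`
    (∀ x, Tendsto (fun t => G2Flow.g2Metric (φ t) x (C.ξ x) (C.ξ x)) (𝓝[<] T) atTop) ∧
    (∀ a < T, ∀ b > T, ¬ ∃ φ' : ℝ → G2Flow.DForm M 3 ℝ,
      G2Flow.IsLaplacianFlow φ' (Ioo a b) ∧ ∀ t ∈ Ioo a T, φ' t = φ t) := by
  subst hT
  have hg : ∀ t, φ t = C.g2Form (ε * G2Flow.ContactCalabiYau.q ε t) := hφ
  have hr : ∀ t < 1 / (8 * ε ^ 2), ε * G2Flow.ContactCalabiYau.q ε t ≠ 0 := fun t ht =>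
    (mul_pos hε (G2Flow.ContactCalabiYau.q_pos hε ht)).ne'
  have hlim : Tendsto (fun t => ε * G2Flow.ContactCalabiYau.q ε t) (𝓝[<] (1 / (8 * ε ^ 2)))
      atTop := (G2Flow.ContactCalabiYau.tendsto_q hε).const_mul_atTop hε
  have hval : ∀ t x v, φ t x v =
      ε * G2Flow.ContactCalabiYau.q ε t * (C.η.wedge C.kahler) x v + C.Υ.re x v :=
    fun t x v => by rw [hφ]; rfl
  refine ⟨?_, fun t ht => ⟨?_, fun x v => ?_⟩, fun t ht => ⟨?_, ?_, fun x X Y => ?_, ?_⟩,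
    fun x => ?_, ?_⟩
  · rw [hφ, G2Flow.ContactCalabiYau.q_zero, mul_one]
  · rw [hg]
    exact C.isG2Structure_g2Form (hr t ht)
  · rw [hg t, C.laplacian3_g2Form (hr t ht)]
    have hd := ((((G2Flow.ContactCalabiYau.hasDerivAt_q hε ht).const_mul ε).mul_const
      ((C.η.wedge C.kahler) x v)).add_const (C.Υ.re x v)).hasDerivWithinAt (s := Iio (1 / (8 * ε ^ 2)))
    simp only [hval]
    refine hd.congr_deriv ?_
    change _ = 4 * (ε * G2Flow.ContactCalabiYau.q ε t) ^ 3 * (C.η.wedge C.kahler) x v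
    ring
  · rw [hg]
    exact C.isCoclosed_g2Form (hr t ht)
  · rw [hg, C.g2Dual_g2Form (hr t ht)]
  · rw [hg, C.g2Metric_g2Form (hr t ht), mul_pow]
  · rw [hg, C.g2Vol_g2Form (hr t ht)]
  · refine ((tendsto_pow_atTop two_ne_zero).comp hlim).congr' ?_
    filter_upwards [self_mem_nhdsWithin] with t ht
    rw [hg, C.g2Metric_g2Form_reeb (hr t ht)]
    rfl
  · rintro a ha b hb ⟨φ', hflow, hext⟩
    obtain ⟨x⟩ := ‹Nonempty M›
    -- On vectors where η∧ω is nonzero, the coefficient εq(t) can be recovered from the value of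
    -- φ_t.
    obtain ⟨v, hv⟩ : ∃ v, (C.η.wedge C.kahler) x v ≠ 0 := by
      by_contra! h
      exact C.η_wedge_kahler_ne_zero x (ContinuousAlternatingMap.ext h)
    -- T is interior to (a, b), so a continuing flow is differentiable, hence continuous, in time at
    -- T; then εq would have a finite limit as t ↑ T.
    have hcont := ((hflow _ ⟨ha, hb⟩).2 x v).continuousWithinAt.continuousAt (Ioo_mem_nhds ha hb)
    have hφ' : Tendsto (fun s => φ' s x v) (𝓝[<] (1 / (8 * ε ^ 2))) (𝓝 _) :=
      hcont.tendsto.mono_left nhdsWithin_le_nhds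
    refine not_tendsto_nhds_of_tendsto_atTop hlim _
      (((hφ'.sub_const (C.Υ.re x v)).div_const ((C.η.wedge C.kahler) x v)).congr' ?_)
    filter_upwards [Ioo_mem_nhdsLT ha] with s hs
    rw [hext s hs, hval, add_sub_cancel_right, mul_div_cancel_right₀ _ hv]
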